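/- **Notation.** For $d<\infty$ let $FM_d=\{FM_d(n)\}_{n\ge 1}$ be the Fulton–MacPherson operad: $FM_d(n)$ is the closure of the image of $\mathrm{Conf}_n(\mathbb R^d)$ under the directions $x_{i,j}=\frac{p_j-p_i}{\|p_j-p_i\|}$ and the relative distances $\frac{\|p_i-p_j\|}{\|p_i-p_k\|}\in[0,\infty]$. Let $FM_\infty(n)=\operatorname{colim}_d FM_d(n)$; operadic composition $\gamma$ is substitution of infinitesimal configurations. An $E_d$-action means an action of $FM_d$; an $E_{d+1}$-action extends an $E_d$-action if its restriction along $FM_d\subset FM_{d+1}$ (induced by $\mathbb R^d\subset\mathbb R^{d+1}$) is the given action. For $\mathbb K=\mathbb C$ (with $d=3$) or $\mathbb K=\mathbb R$ (with $d=2$), realize $\mathbb{KP}^\infty$ (that is, $BU(1)$ or $BO(1)$) as the projectivization of $\mathbb K[t]$ with the colimit topology, a topological monoid under multiplication of polynomials. Identify $S^{d-1}\cong\mathbb{KP}^1\subset\mathbb{KP}^\infty$ by stereographic projection from the north pole, $z\leftrightarrow[t-z]$, $\infty\leftrightarrow[1]$. Let $D_n=FM_\infty(n)\times_{\Sigma_n}(\mathbb{KP}^\infty)^n$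 and $D=\bigsqcup_{n\ge0}D_n$. The maps $$\nu_{n:k_1,\dots,k_n}\colon FM_d(n)\times\prod_{i=1}^n D_{k_i}\to D_{k_1+\dots+k_n}$$ send $p$ and $[r_i;y_{i,1},\dots,y_{i,k_i}]$ to the class of $\gamma(p;r_1,\dots,r_n)\in FM_\infty(\sum_i k_i)$ with labels $\big(\prod_{j\ne i}x_{i,j}(p)^{k_j}\big)\,y_{i,a}$. Let $F_n\subset D_n$ be the subspace of classes whose $n$ labels lie in $\mathbb{KP}^{n-1}$ (polynomials of degree $<n$) and are projectively independent; $F_n$ is the model of the unordered flag manifold $\mathrm{Fl}_n(\mathbb K)/\Sigma_n$. The Atiyah $E_d$-action on $\bigsqcup_{n\ge 0}F_n$ is the one whose structure maps are the restrictions of the maps $\nu$ (it exists if and only if these restrictions take values in $\bigsqcup_n F_n$, which is the $E_3$-, respectively real $E_2$-, Atiyah–Sutcliffe conjecture). **Proposition.** 1. The Atiyah $E_3$-action on $\bigsqcup_n \mathrm{Fl}_n(\mathbb C)/\Sigma_n$ does not extend to an $E_4$-action: there is no $FM_4$-action on $\bigsqcup_n F_n$ (for $\mathbb K=\mathbb C$)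 whose restriction to $FM_3$ has the maps $\nu$ as structure maps. 2. The Atiyah $E_2$-action on $\bigsqcup_n \mathrm{Fl}_n(\mathbb R)/\Sigma_n$ does not extend to an $E_3$-action: there is no $FM_3$-action on $\bigsqcup_n F_n$ (for $\mathbb K=\mathbb R$) whose restriction to $FM_2$ has the maps $\nu$ as structure maps. 3. Let $*\in D_1(BU(1))$ be a point labelled by the unit $[1]\in BU(1)$. The map $\varphi\colon S^2\to D_2(BU(1))$, $p\mapsto\nu_{2:1,1}((p,-p),*,*)$, is continuous and not null-homotopic (that is, it is non-zero in $\pi_2(D_2(BU(1)))$). 4. The map $\nu_{2:1,1}(\cdot,*,*)\colon FM_3(2)\to D_2(BU(1))$ does not extend to a continuous map $FM_4(2)\to D_2(BU(1))$. -/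

import Mathlib

open scoped ENNReal Topology LinearAlgebra.Projectivization Polynomial

noncomputable section

namespace FlagOperad

/-! ### Fulton--MacPherson spaces -/

/-- Euclidean space `ℝ^d`. -/
abbrev E (d : ℕ) : Type := EuclideanSpace ℝ (Fin d)

/-- Extension by zero `ℝ^d → ℝ^ℕ`, which identifies `ℝ^d` with the sequences supported in
the first `d` places. -/
def pad {d : ℕ} (v : E d) : ℕ → ℝ := fun n => if h : n < d then v ⟨n, h⟩ else 0

/-- Ambient space of direction coordinates `x i j` and relative distance coordinates `s i j k`.
All the coordinates whose indices are not distinct are constant on configurations, so keeping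
them does not change closures. -/
abbrev Coord (ι : Type) : Type := (ι → ι → ℕ → ℝ) × (ι → ι → ι → ℝ≥0∞)

/-- The coordinates of a configuration: `x i j = (p j - p i) / ‖p j - p i‖` and
`s i j k = ‖p i - p j‖ / ‖p i - p k‖ ∈ [0, ∞]`. -/
def coords {d : ℕ} {ι : Type} (p : ι → E d) : Coord ι :=
  (fun i j => pad (‖p j - p i‖⁻¹ • (p j - p i)),
   fun i j k => edist (p i) (p j) / edist (p i) (p k))

/-- The coordinates of the configurations of distinct points of `ℝ^d` labelled by `ι`. -/
def confSet (d : ℕ) (ι : Type) : Set (Coord ι) := coords '' {p : ι → E d | Function.Injective p}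

/-- The Fulton--MacPherson space `FM_d(ι)`: the closure of the set of configurations (modulo
translations and dilations) in the space of coordinates. -/
def FM (d : ℕ) (ι : Type) : Type := closure (confSet d ι)

instance (d : ℕ) (ι : Type) : TopologicalSpace (FM d ι) :=
  inferInstanceAs (TopologicalSpace (closure (confSet d ι)))

/-- Relabelling of coordinates. -/
def Coord.reindex {ι κ : Type} (f : κ → ι) (a : Coord ι) : Coord κ :=
  (fun i j => a.1 (f i) (f j), fun i j k => a.2 (f i) (f j) (f k))

/-- Operadic composition in coordinates: the points with label `i` in `p` are replaced by
infinitesimally small copies of `q i`. Two points in different copies see each other as the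
corresponding points of `p` do. -/
def Coord.comp {ι : Type} {κ : ι → Type} (p : Coord ι) (q : ∀ i, Coord (κ i)) :
    Coord (Σ i, κ i) := by
  classical
  exact
    (fun a b => if h : b.1 = a.1 then (q a.1).1 a.2 (h ▸ b.2) else p.1 a.1 b.1,
     fun a b c => if h : b.1 = a.1 ∧ c.1 = a.1 then (q a.1).2 a.2 (h.1 ▸ b.2) (h.2 ▸ c.2)
       else p.2 a.1 b.1 c.1)

lemma Coord.continuous_reindex {ι κ : Type} (f : κ → ι) :
    Continuous (Coord.reindex f) := by
  unfold Coord.reindex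
  fun_prop

lemma Coord.continuous_comp {ι : Type} {κ : ι → Type} :
    Continuous (fun z : Coord ι × (∀ i, Coord (κ i)) => Coord.comp z.1 z.2) := by
  classical
  unfold Coord.comp
  refine Continuous.prodMk ?_ ?_
  · refine continuous_pi fun a => continuous_pi fun b => ?_
    by_cases h : b.1 = a.1
    · simp only [h, dite_true]; fun_prop
    · simp only [h, dite_false]; fun_prop
  · refine continuous_pi fun a => continuous_pi fun b => continuous_pi fun c => ?_
    by_cases h : b.1 = a.1 ∧ c.1 = a.1
    · simp only [h, and_self, dite_true]; fun_prop
    · simp only [h, dite_false]; fun_prop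

lemma continuous_pad {d : ℕ} : Continuous (pad : E d → ℕ → ℝ) := by
  unfold pad
  refine continuous_pi fun n => ?_
  by_cases h : n < d
  · simp only [h, dite_true]; fun_prop
  · simp only [h, dite_false]; fun_prop

lemma reindex_mem {d : ℕ} {ι κ : Type} {f : κ → ι} (hf : Function.Injective f) {a : Coord ι}
    (ha : a ∈ closure (confSet d ι)) : a.reindex f ∈ closure (confSet d κ) := by
  refine map_mem_closure (Coord.continuous_reindex f) ha ?_
  rintro _ ⟨p, hp, rfl⟩
  exact ⟨p ∘ f, hp.comp hf, rfl⟩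

/-- The composite of two genuine configurations is a limit of genuine configurations. -/
lemma comp_coords_mem {d : ℕ} {ι : Type} {κ : ι → Type} [Finite ι] [∀ i, Finite (κ i)]
    {p : ι → E d} (hp : Function.Injective p) {q : ∀ i, κ i → E d}
    (hq : ∀ i, Function.Injective (q i)) :
    Coord.comp (coords p) (fun i => coords (q i)) ∈ closure (confSet d (Σ i, κ i)) := by
  classical
  let c : ℝ → (Σ i, κ i) → E d := fun ε a => p a.1 + ε • q a.1 a.2
  have hc : ∀ a, Filter.Tendsto (fun ε => c ε a) (𝓝[>] 0) (𝓝 (p a.1)) := by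
    intro a
    have : Continuous fun ε : ℝ => c ε a := by simp only [c]; fun_prop
    have h2 := this.tendsto 0
    simp only [c, zero_smul, add_zero] at h2
    exact h2.mono_left nhdsWithin_le_nhds
  have hpos : ∀ᶠ ε : ℝ in 𝓝[>] 0, 0 < ε := eventually_mem_nhdsWithin
  have hinj : ∀ᶠ ε : ℝ in 𝓝[>] 0, Function.Injective (c ε) := by
    have : ∀ a b : (Σ i, κ i), ∀ᶠ ε : ℝ in 𝓝[>] 0, c ε a = c ε b → a = b := by
      rintro ⟨i, a⟩ ⟨j, b⟩
      by_cases hij : i = j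
      · subst hij
        filter_upwards [hpos] with ε hε h
        have h1 : ε • q i a = ε • q i b := by simpa [c] using h
        have h2 := smul_right_injective (E d) hε.ne' h1
        rw [hq i h2]
      · have hne : p i ≠ p j := fun h => hij (hp h)
        have h3 := (((hc ⟨i, a⟩).prodMk_nhds (hc ⟨j, b⟩)).eventually
          ((isClosed_diagonal (X := E d)).isOpen_compl.mem_nhds (by simpa using hne)))
        filter_upwards [h3] with ε hε h
        exact absurd h (by simpa using hε)
    have h' : ∀ᶠ ε : ℝ in 𝓝[>] 0, ∀ a b, c ε a = c ε b → a = b :=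
      Filter.eventually_all.2 fun a => Filter.eventually_all.2 fun b => this a b
    filter_upwards [h'] with ε hε a b using hε a b
  refine mem_closure_of_tendsto (f := fun ε => coords (c ε)) (b := 𝓝[>] (0 : ℝ)) ?_ ?_
  · refine Filter.Tendsto.prodMk_nhds ?_ ?_
    · refine tendsto_pi_nhds.2 fun ⟨i, a⟩ => tendsto_pi_nhds.2 fun ⟨j, b⟩ => ?_
      by_cases h : j = i
      · subst h
        refine tendsto_const_nhds.congr' ?_
        filter_upwards [hpos] with ε hε
        have e1 : c ε ⟨j, b⟩ - c ε ⟨j, a⟩ = ε • (q j b - q j a) := by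
          simp [c, smul_sub]
        simp only [coords, dite_true, e1]
        rw [norm_smul, Real.norm_of_nonneg hε.le, smul_smul, mul_inv, mul_right_comm,
          inv_mul_cancel₀ hε.ne', one_mul]
      · have hne : p j - p i ≠ 0 := sub_ne_zero.2 fun h' => h (hp h')
        have h1 := (hc ⟨j, b⟩).sub (hc ⟨i, a⟩)
        have h2 := (h1.norm.inv₀ (norm_ne_zero_iff.2 hne)).smul h1
        have h3 := (continuous_pad.tendsto _).comp h2
        simpa [Coord.comp, coords, h, Function.comp_def] using h3
    · refine tendsto_pi_nhds.2 fun ⟨i, a⟩ => tendsto_pi_nhds.2 fun ⟨j, b⟩ =>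
        tendsto_pi_nhds.2 fun ⟨k, e⟩ => ?_
      by_cases h : j = i ∧ k = i
      · obtain ⟨rfl, rfl⟩ := h
        refine tendsto_const_nhds.congr' ?_
        filter_upwards [hpos] with ε hε
        have e1 : ∀ x y, edist (c ε ⟨k, x⟩) (c ε ⟨k, y⟩)
            = ENNReal.ofReal ε * edist (q k x) (q k y) := by
          intro x y
          simp only [c, edist_add_left, edist_smul₀]
          rw [ENNReal.smul_def, smul_eq_mul, ENNReal.ofReal, Real.toNNReal_eq_nnnorm_of_nonneg hε.le]
        simp only [coords, and_self, dite_true, e1]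
        exact (ENNReal.mul_div_mul_left _ _ (by simpa using hε) ENNReal.ofReal_ne_top).symm
      · have h0 : edist (p i) (p j) ≠ 0 ∨ edist (p i) (p k) ≠ 0 := by
          by_contra! h'
          simp only [edist_eq_zero] at h'
          exact h ⟨(hp h'.1).symm, (hp h'.2).symm⟩
        have := ENNReal.Tendsto.div ((hc ⟨i, a⟩).edist (hc ⟨j, b⟩)) h0
          ((hc ⟨i, a⟩).edist (hc ⟨k, e⟩)) (Or.inl (edist_ne_top _ _))
        simpa only [Coord.comp, coords, h, dite_false] using this
  · filter_upwards [hinj] with ε hε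
    exact ⟨c ε, hε, rfl⟩

lemma comp_mem {d : ℕ} {ι : Type} {κ : ι → Type} [Finite ι] [∀ i, Finite (κ i)] {p : Coord ι}
    (hp : p ∈ closure (confSet d ι)) {q : ∀ i, Coord (κ i)}
    (hq : ∀ i, q i ∈ closure (confSet d (κ i))) :
    p.comp q ∈ closure (confSet d (Σ i, κ i)) := by
  have h : (p, q) ∈ closure (confSet d ι ×ˢ Set.univ.pi fun i => confSet d (κ i)) := by
    rw [closure_prod_eq, closure_pi_set]
    exact ⟨hp, fun i _ => hq i⟩
  rw [← closure_closure]
  refine map_mem_closure (f := fun z : Coord ι × (∀ i, Coord (κ i)) => Coord.comp z.1 z.2)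
    Coord.continuous_comp h ?_
  rintro ⟨p, q⟩ ⟨⟨p', hp', rfl⟩, hq'⟩
  choose q' h1 h2 using fun i => hq' i (Set.mem_univ i)
  have : q = fun i => coords (q' i) := funext fun i => (h2 i).symm
  subst this
  exact comp_coords_mem hp' h1

/-- The standard isometric inclusion `ℝ^d → ℝ^e` (for `d ≤ e`). -/
def stab {d : ℕ} (e : ℕ) (v : E d) : E e := WithLp.toLp 2 fun i => pad v i

lemma pad_stab {d e : ℕ} (h : d ≤ e) (v : E d) : pad (stab e v) = pad v := by
  funext n
  by_cases hn : n < e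
  · simp [pad, stab, hn]
  · simp [pad, hn, show ¬ n < d by omega]

lemma norm_stab {d e : ℕ} (h : d ≤ e) (v : E d) : ‖stab e v‖ = ‖v‖ := by
  have key : ∀ (m : ℕ) (w : E m), ‖w‖ = √(∑ i ∈ Finset.range m, (pad w i) ^ 2) := by
    intro m w
    rw [EuclideanSpace.norm_eq, ← Fin.sum_univ_eq_sum_range]
    simp [pad]
  rw [key, key, pad_stab h]
  congr 1
  refine (Finset.sum_subset (Finset.range_mono h) fun n _ hn => ?_).symm
  simp only [Finset.mem_range] at hn
  simp [pad, hn]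

lemma stab_sub {d e : ℕ} (v w : E d) : stab e (v - w) = stab e v - stab e w := by
  ext i
  by_cases hi : (i : ℕ) < d <;> simp [stab, pad, hi]

lemma stab_smul {d e : ℕ} (c : ℝ) (v : E d) : stab e (c • v) = c • stab e v := by
  ext i
  by_cases hi : (i : ℕ) < d <;> simp [stab, pad, hi]

lemma edist_stab {d e : ℕ} (h : d ≤ e) (v w : E d) : edist (stab e v) (stab e w) = edist v w := by
  rw [edist_dist, edist_dist, dist_eq_norm, dist_eq_norm, ← stab_sub, norm_stab h]

lemma confSet_mono {d e : ℕ} (h : d ≤ e) (ι : Type) : confSet d ι ⊆ confSet e ι := by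
  rintro _ ⟨p, hp, rfl⟩
  refine ⟨fun i => stab e (p i), fun i j hij => hp ?_, ?_⟩
  · have := edist_stab h (p i) (p j)
    rw [show stab e (p i) = stab e (p j) from hij, edist_self] at this
    exact edist_eq_zero.1 this.symm
  · unfold coords
    simp only [edist_stab h, ← stab_sub, norm_stab h, ← stab_smul, pad_stab h]

/-- The inclusion `FM_d(ι) → FM_e(ι)` induced by `ℝ^d ⊆ ℝ^e`. -/
def FM.incl {d e : ℕ} (h : d ≤ e) {ι : Type} (p : FM d ι) : FM e ι :=
  ⟨p.1, closure_mono (confSet_mono h ι) p.2⟩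

/-- A configuration, as a point of the Fulton--MacPherson space. -/
def FM.ofConf {d : ℕ} {ι : Type} (p : ι → E d) (hp : Function.Injective p) : FM d ι :=
  ⟨coords p, subset_closure ⟨p, hp, rfl⟩⟩

/-- Relabelling of points. -/
def FM.reindex {d : ℕ} {ι κ : Type} (e : κ ≃ ι) (p : FM d ι) : FM d κ :=
  ⟨p.1.reindex e, reindex_mem e.injective p.2⟩

/-- Operadic composition of the Fulton--MacPherson operad. -/
def FM.comp {d : ℕ} {ι : Type} {κ : ι → Type} [Finite ι] [∀ i, Finite (κ i)]
    (p : FM d ι) (q : ∀ i, FM d (κ i)) : FM d (Σ i, κ i) :=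
  ⟨p.1.comp fun i => (q i).1, comp_mem p.2 fun i => (q i).2⟩

/-- `FM_∞(ι)`, the union of the spaces `FM_d(ι)`. -/
def FMInf (ι : Type) : Type := {a : Coord ι // ∃ d : ℕ, a ∈ closure (confSet d ι)}

/-- The inclusion `FM_d(ι) → FM_∞(ι)`. -/
def FM.toInf {d : ℕ} {ι : Type} (p : FM d ι) : FMInf ι := ⟨p.1, d, p.2⟩

/-- `FM_∞(ι)` carries the colimit topology. -/
instance (ι : Type) : TopologicalSpace (FMInf ι) :=
  ⨆ d : ℕ, TopologicalSpace.coinduced (FM.toInf (d := d)) inferInstance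

def FMInf.reindex {ι κ : Type} (e : κ ≃ ι) (p : FMInf ι) : FMInf κ :=
  ⟨p.1.reindex e, p.2.imp fun _ h => reindex_mem e.injective h⟩

def FMInf.comp {ι : Type} {κ : ι → Type} [Finite ι] [∀ i, Finite (κ i)]
    (p : FMInf ι) (q : ∀ i, FMInf (κ i)) : FMInf (Σ i, κ i) :=
  ⟨p.1.comp fun i => (q i).1, by
    obtain ⟨d, hd⟩ := p.2
    choose e he using fun i => (q i).2
    obtain ⟨m, hm⟩ := (Set.finite_range e).bddAbove
    exact ⟨max d m, comp_mem (closure_mono (confSet_mono (le_max_left _ _) _) hd) fun i =>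
      closure_mono (confSet_mono ((hm ⟨i, rfl⟩).trans (le_max_right _ _)) _) (he i)⟩⟩

/-! ### Algebras over the Fulton--MacPherson operad -/

/-- An action of the operad `FM_d = {FM_d(n)}_{n ≥ 1}` on a space `X`. (The composition of
`FM_d` is indexed by the bijection `(Σ i, Fin (m i)) ≃ Fin (∑ i, m i)`; `FM_d(1)` is a point.) -/
structure Action (d : ℕ) (X : Type) [TopologicalSpace X] where
  act : ∀ (n : ℕ) [NeZero n], FM d (Fin n) → (Fin n → X) → X
  continuous_act : ∀ (n : ℕ) [NeZero n],
    Continuous fun z : FM d (Fin n) × (Fin n → X) => act n z.1 z.2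
  equivariant : ∀ (n : ℕ) [NeZero n] (σ : Equiv.Perm (Fin n)) (p : FM d (Fin n)) (x : Fin n → X),
    act n (p.reindex σ) (x ∘ σ) = act n p x
  unit : ∀ (p : FM d (Fin 1)) (x : Fin 1 → X), act 1 p x = x 0
  assoc : ∀ (n : ℕ) [NeZero n] (m : Fin n → ℕ) [∀ i, NeZero (m i)] [NeZero (∑ i, m i)]
    (p : FM d (Fin n)) (q : ∀ i, FM d (Fin (m i))) (x : Fin (∑ i, m i) → X),
    act (∑ i, m i) ((p.comp q).reindex finSigmaFinEquiv.symm) x =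
      act n p fun i => act (m i) (q i) fun j => x (finSigmaFinEquiv ⟨i, j⟩)

lemma FM.continuous_incl {d e : ℕ} (h : d ≤ e) {ι : Type} :
    Continuous (FM.incl h : FM d ι → FM e ι) :=
  Continuous.subtype_mk continuous_subtype_val _

/-- The underlying `FM_d`-action of an `FM_e`-action, for `d ≤ e`. -/
def Action.restrict {d e : ℕ} (h : d ≤ e) {X : Type} [TopologicalSpace X] (B : Action e X) :
    Action d X where
  act n _ p x := B.act n (p.incl h) x
  continuous_act n _ := (B.continuous_act n).comp
    (((FM.continuous_incl h).comp continuous_fst).prodMk continuous_snd)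
  equivariant n _ σ p x := B.equivariant n σ (p.incl h) x
  unit p x := B.unit (p.incl h) x
  assoc n _ m _ _ p q x := B.assoc n m (p.incl h) (fun i => (q i).incl h) x

/-! ### The monoids `BU(1)` and `BO(1)` as projective spaces of polynomials -/

/-- The infinite projective space `𝕜P^∞`, realized as the projectivization of `𝕜[t]`;
it is `BU(1)` for `𝕜 = ℂ` and `BO(1)` for `𝕜 = ℝ`. -/
def PInf (𝕜 : Type) [RCLike 𝕜] : Type := ℙ 𝕜 𝕜[X]

/-- The class of a nonzero polynomial. -/
def PInf.mk {𝕜 : Type} [RCLike 𝕜] (f : 𝕜[X]) (hf : f ≠ 0) : PInf 𝕜 := Projectivization.mk 𝕜 f hf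

lemma ofFn_ne_zero {𝕜 : Type} [RCLike 𝕜] {m : ℕ} {v : Fin m → 𝕜} (hv : v ≠ 0) :
    Polynomial.ofFn m v ≠ 0 := by
  classical
  intro h
  apply hv
  funext i
  have := congrArg (fun f => Polynomial.coeff f i) h
  simpa using this

/-- The map `𝕜^m ∖ {0} → 𝕜P^{m-1} ⊆ 𝕜P^∞`, `v ↦ [∑ v_i t^i]`. -/
def PInf.ofVec {𝕜 : Type} [RCLike 𝕜] (m : ℕ) (v : {v : Fin m → 𝕜 // v ≠ 0}) : PInf 𝕜 :=
  PInf.mk (Polynomial.ofFn m v.1) (ofFn_ne_zero v.2)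

/-- The colimit topology of the quotient topologies of `𝕜P^{m-1}`. -/
instance (𝕜 : Type) [RCLike 𝕜] : TopologicalSpace (PInf 𝕜) :=
  ⨆ m : ℕ, TopologicalSpace.coinduced (PInf.ofVec (𝕜 := 𝕜) m) inferInstance

/-- Multiplication of polynomials makes `𝕜P^∞` a commutative monoid. -/
instance (𝕜 : Type) [RCLike 𝕜] : One (PInf 𝕜) := ⟨PInf.mk 1 one_ne_zero⟩

instance (𝕜 : Type) [RCLike 𝕜] : Mul (PInf 𝕜) :=
  ⟨fun x y => PInf.mk (Projectivization.rep x * Projectivization.rep y)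
    (mul_ne_zero (Projectivization.rep_nonzero x) (Projectivization.rep_nonzero y))⟩

lemma PInf.one_def {𝕜 : Type} [RCLike 𝕜] : (1 : PInf 𝕜) = PInf.mk 1 one_ne_zero := rfl

lemma PInf.ind {𝕜 : Type} [RCLike 𝕜] {P : PInf 𝕜 → Prop} (h : ∀ f hf, P (PInf.mk f hf)) :
    ∀ x, P x := Projectivization.ind h

lemma PInf.mk_mul_mk {𝕜 : Type} [RCLike 𝕜] {f g : 𝕜[X]} (hf : f ≠ 0) (hg : g ≠ 0) :
    PInf.mk f hf * PInf.mk g hg = PInf.mk (f * g) (mul_ne_zero hf hg) := by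
  obtain ⟨a, ha⟩ := Projectivization.exists_smul_eq_mk_rep 𝕜 f hf
  obtain ⟨b, hb⟩ := Projectivization.exists_smul_eq_mk_rep 𝕜 g hg
  refine (Projectivization.mk_eq_mk_iff 𝕜 _ _ _ _).2 ⟨a * b, ?_⟩
  change _ = (Projectivization.mk 𝕜 f hf).rep * (Projectivization.mk 𝕜 g hg).rep
  rw [← ha, ← hb, smul_mul_smul_comm]

lemma PInf.mk_congr {𝕜 : Type} [RCLike 𝕜] {f g : 𝕜[X]} (hf : f ≠ 0) (hg : g ≠ 0) (h : f = g) :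
    PInf.mk f hf = PInf.mk g hg := by
  subst h; rfl

instance (𝕜 : Type) [RCLike 𝕜] : CommMonoid (PInf 𝕜) where
  mul_assoc x y z := by
    induction x using PInf.ind
    induction y using PInf.ind
    induction z using PInf.ind
    simp only [PInf.mk_mul_mk]
    exact PInf.mk_congr _ _ (mul_assoc _ _ _)
  one_mul x := by
    induction x using PInf.ind
    simp only [PInf.one_def, PInf.mk_mul_mk]
    exact PInf.mk_congr _ _ (one_mul _)
  mul_one x := by
    induction x using PInf.ind
    simp only [PInf.one_def, PInf.mk_mul_mk]
    exact PInf.mk_congr _ _ (mul_one _)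
  mul_comm x y := by
    induction x using PInf.ind
    induction y using PInf.ind
    simp only [PInf.mk_mul_mk]
    exact PInf.mk_congr _ _ (mul_comm _ _)

/-- Stereographic projection from the north pole `S^2 ≅ ℂ ∪ {∞} = ℂP^1 ⊆ ℂP^∞`, where `z ∈ ℂ`
corresponds to `[t - z]` and `∞` corresponds to `[1]`. -/
def stereoC (v : ℕ → ℝ) : PInf ℂ :=
  if v 2 = 1 then 1
  else PInf.mk (Polynomial.X - Polynomial.C (((v 0 : ℂ) + (v 1 : ℂ) * Complex.I) / (1 - (v 2 : ℂ))))
    (Polynomial.X_sub_C_ne_zero _)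

/-- Stereographic projection from the north pole `S^1 ≅ ℝ ∪ {∞} = ℝP^1 ⊆ ℝP^∞`. -/
def stereoR (v : ℕ → ℝ) : PInf ℝ :=
  if v 1 = 1 then 1
  else PInf.mk (Polynomial.X - Polynomial.C (v 0 / (1 - v 1))) (Polynomial.X_sub_C_ne_zero _)

/-! ### Extended powers, the weighted Atiyah maps and the structure maps `ν` -/

/-- The orbit relation of `Σ_n` on `FM_∞(n) × (𝕜P^∞)^n`. -/
instance orbitSetoid (𝕜 : Type) [RCLike 𝕜] (n : ℕ) : Setoid (FMInf (Fin n) × (Fin n → PInf 𝕜)) where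
  r a b := ∃ σ : Equiv.Perm (Fin n), b = (a.1.reindex σ, a.2 ∘ σ)
  iseqv :=
    { refl := fun _ => ⟨Equiv.refl _, rfl⟩
      symm := by
        rintro a _ ⟨σ, rfl⟩
        refine ⟨σ.symm, Prod.ext (Subtype.ext ?_) ?_⟩
        · simp [FMInf.reindex, Coord.reindex]
        · funext i; simp
      trans := by
        rintro a _ _ ⟨σ, rfl⟩ ⟨τ, rfl⟩
        exact ⟨τ.trans σ, rfl⟩ }

/-- The extended power `D_n(𝕜P^∞) = FM_∞(n) ×_{Σ_n} (𝕜P^∞)^n`, with the quotient topology. -/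
abbrev D (𝕜 : Type) [RCLike 𝕜] (n : ℕ) : Type := Quotient (orbitSetoid 𝕜 n)

/-- The disjoint union `D(𝕜P^∞) = ⊔_n D_n(𝕜P^∞)`. -/
abbrev DTotal (𝕜 : Type) [RCLike 𝕜] : Type := Σ n : ℕ, D 𝕜 n

/-- The weighted Atiyah map: its `i`-th component is the product over `j ≠ i` of the `w j`-th
powers of the points of `𝕜P^1` that correspond to the directions `x i j`. The identification `τ` of
the sphere of directions with `𝕜P^1` is a parameter. -/
def atiyah {𝕜 : Type} [RCLike 𝕜] (τ : (ℕ → ℝ) → PInf 𝕜) {d n : ℕ} (w : Fin n → ℕ)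
    (p : FM d (Fin n)) (i : Fin n) : PInf 𝕜 :=
  ∏ j ∈ Finset.univ.erase i, τ (p.1.1 i j) ^ w j

/-- The structure map `ν` on representatives: compose in `FM_∞`, and multiply the labels of the
`i`-th input by the `i`-th component of the Atiyah map with weights `k`. -/
def nuMk {𝕜 : Type} [RCLike 𝕜] (τ : (ℕ → ℝ) → PInf 𝕜) {d n : ℕ} (p : FM d (Fin n)) (k : Fin n → ℕ)
    (r : ∀ i, FMInf (Fin (k i)) × (Fin (k i) → PInf 𝕜)) : D 𝕜 (∑ i, k i) :=
  Quotient.mk _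
    ((p.toInf.comp fun i => (r i).1).reindex finSigmaFinEquiv.symm,
      fun a => atiyah τ k p (finSigmaFinEquiv.symm a).1 *
        (r (finSigmaFinEquiv.symm a).1).2 (finSigmaFinEquiv.symm a).2)

/-- The structure map `ν_{n : k_1, …, k_n} : FM_d(n) × ∏ D_{k_i} → D_{k_1 + ⋯ + k_n}`, on all
components of `D` at once. It does not depend on the representatives, see `nu_mk`. -/
def nu {𝕜 : Type} [RCLike 𝕜] (τ : (ℕ → ℝ) → PInf 𝕜) {d n : ℕ} (p : FM d (Fin n))
    (y : Fin n → DTotal 𝕜) : DTotal 𝕜 :=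
  ⟨∑ i, (y i).1, nuMk τ p (fun i => (y i).1) fun i => (y i).2.out⟩

lemma Coord.comp_reindex {ι : Type} {κ κ' : ι → Type} (p : Coord ι) (q : ∀ i, Coord (κ i))
    (f : ∀ i, κ' i → κ i) :
    (p.comp fun i => (q i).reindex (f i)) = (p.comp q).reindex (Sigma.map id f) := by
  refine Prod.ext ?_ ?_
  · funext ⟨i, a⟩ ⟨j, b⟩
    by_cases h : j = i
    · subst h; simp [Coord.comp, Coord.reindex, Sigma.map]
    · simp [Coord.comp, Coord.reindex, Sigma.map, h]
  · funext ⟨i, a⟩ ⟨j, b⟩ ⟨k, c⟩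
    by_cases h : j = i ∧ k = i
    · obtain ⟨rfl, rfl⟩ := h; simp [Coord.comp, Coord.reindex, Sigma.map]
    · simp [Coord.comp, Coord.reindex, Sigma.map, h]

lemma nuMk_congr {𝕜 : Type} [RCLike 𝕜] (τ : (ℕ → ℝ) → PInf 𝕜) {d n : ℕ} (p : FM d (Fin n))
    (k : Fin n → ℕ) {r r' : ∀ i, FMInf (Fin (k i)) × (Fin (k i) → PInf 𝕜)}
    (h : ∀ i, orbitSetoid 𝕜 (k i) (r i) (r' i)) : nuMk τ p k r = nuMk τ p k r' := by
  choose σ hσ using h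
  obtain rfl : r' = fun i => ((r i).1.reindex (σ i), (r i).2 ∘ σ i) := funext hσ
  refine Quotient.sound
    ⟨(finSigmaFinEquiv.symm.trans (Equiv.sigmaCongrRight σ)).trans finSigmaFinEquiv, ?_⟩
  refine Prod.ext (Subtype.ext ?_) ?_
  · have := Coord.comp_reindex p.1 (fun i => (r i).1.1) (fun i => σ i)
    simp only [FMInf.reindex, FMInf.comp, FM.toInf]
    rw [this]
    simp [Coord.reindex, Sigma.map]
  · funext a
    have h : ∀ s t : (Σ i, Fin (k i)), s = t → (r s.1).2 s.2 = (r t.1).2 t.2 := by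
      rintro s _ rfl; rfl
    have h2 : finSigmaFinEquiv.symm (finSigmaFinEquiv
        ((Equiv.sigmaCongrRight σ) (finSigmaFinEquiv.symm a))) =
        (Equiv.sigmaCongrRight σ) (finSigmaFinEquiv.symm a) := Equiv.symm_apply_apply _ _
    simp only [Function.comp_apply, Equiv.trans_apply]
    rw [h _ _ h2, h2]
    rfl

/-- The value of `ν` on the classes of arbitrary representatives. -/
lemma nu_mk {𝕜 : Type} [RCLike 𝕜] (τ : (ℕ → ℝ) → PInf 𝕜) {d n : ℕ} (p : FM d (Fin n))
    (k : Fin n → ℕ) (r : ∀ i, FMInf (Fin (k i)) × (Fin (k i) → PInf 𝕜)) :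
    nu τ p (fun i => ⟨k i, Quotient.mk _ (r i)⟩) = ⟨∑ i, k i, nuMk τ p k r⟩ := by
  unfold nu
  exact congrArg _ (nuMk_congr τ p k fun i => Quotient.mk_out (r i))

/-- The base point `*` of `𝕜P^∞`, seen in `D_1(𝕜P^∞)` as one point labelled by `1`. -/
def basePoint (𝕜 : Type) [RCLike 𝕜] : DTotal 𝕜 :=
  ⟨1, Quotient.mk _
    ((FM.ofConf (fun _ : Fin 1 => (0 : E 1)) (Function.injective_of_subsingleton _)).toInf,
      fun _ => 1)⟩

/-! ### Unordered flag manifolds -/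

/-- The subspace `F_n ⊆ D_n(𝕜P^∞)`, a model of `Fl_n(𝕜)/Σ_n`: the labels lie in `𝕜P^{n-1}`
(polynomials of degree less than `n`) and are projectively independent. -/
def flagSet (𝕜 : Type) [RCLike 𝕜] (n : ℕ) : Set (D 𝕜 n) :=
  {y | ∃ (r : FMInf (Fin n)) (x : Fin n → ℙ 𝕜 𝕜[X]), y = Quotient.mk _ (r, x) ∧
    (∀ i, (x i).submodule ≤ Polynomial.degreeLT 𝕜 n) ∧ Projectivization.Independent x}

/-- The disjoint union `⊔_n F_n`, as a subspace of `D(𝕜P^∞)`. -/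
abbrev FlagTotal (𝕜 : Type) [RCLike 𝕜] : Type := {y : DTotal 𝕜 // y.2 ∈ flagSet 𝕜 y.1}

/-- `A` is the Atiyah action on the unordered flag manifolds: its structure maps are the
restrictions of the maps `ν`. -/
def IsAtiyahAction {𝕜 : Type} [RCLike 𝕜] (τ : (ℕ → ℝ) → PInf 𝕜) {d : ℕ}
    (A : Action d (FlagTotal 𝕜)) : Prop :=
  ∀ (n : ℕ) [NeZero n] (p : FM d (Fin n)) (x : Fin n → FlagTotal 𝕜),
    (A.act n p x).1 = nu τ p fun i => (x i).1

lemma antipodal_injective {d : ℕ} (p : Metric.sphere (0 : E d) 1) :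
    Function.Injective ![(p : E d), -p] := by
  have hp : (p : E d) ≠ 0 := ne_zero_of_mem_unit_sphere p
  have h1 : (p : E d) ≠ -p := fun h => hp <| by
    have h2 : (2 : ℝ) • (p : E d) = 0 := by
      rw [two_smul]
      exact add_eq_zero_iff_eq_neg.2 h
    simpa using h2
  intro i j h
  fin_cases i <;> fin_cases j <;> simp_all

/-- The point `(p, -p)` of `FM_d(2)`, for `p` in the unit sphere. -/
def antipodal {d : ℕ} (p : Metric.sphere (0 : E d) 1) : FM d (Fin 2) :=
  FM.ofConf ![(p : E d), -p] (antipodal_injective p)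

end FlagOperad

end

/-! All four claims rest on one fact: the inclusion of the sphere of directions as the projective
line in the infinite projective space is essential (`stereoC_not_nullhomotopic`,
`stereoR_not_nullhomotopic`). Evaluating the binary structure map at two base points gives the
two-point configuration with each point labelled by its direction to the other (`nu_basePoint`).
Restricted to antipodal pairs, this is a map from the sphere to the quadratic extended power. With
one more ambient dimension the antipodal pairs can be contracted (`suspAntipodal_nullhomotopic`), so
any extension would make this map nullhomotopic.

It is not nullhomotopic. The orbit map to the quadratic extended power is a double covering, because
swapping two points negates their direction (`isCoveringMap_D`). A nullhomotopy on the connected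
sphere therefore lifts to labelled configurations, and reading off the label of the second point
makes the stereographic inclusion of the sphere nullhomotopic.

Essentiality is proved without characteristic classes. A point of projective space is regarded as
the orthogonal projection to a line in a Hilbert space. Projections closer than 1 in norm carry
nonvanishing sections to nonvanishing sections, so the line bundle pulled back along a nullhomotopic
map has a nowhere zero section (`exists_section_of_nullhomotopic`). Over the two disc charts of the
sphere, coordinates of this section are nonvanishing functions that differ on the equator by the
factor `-w` (`IsStereo.exists_clutching`). Winding numbers rule this out over the complex numbers,
and signs rule it out over the reals. -/

noncomputable section

open scoped unitInterval

namespace FlagOperad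

/-! ### Nonvanishing functions on the plane and on the line -/

/-- A continuous nonvanishing function on the plane has a continuous logarithm along the unit
circle. -/
lemma exists_log_circle {b : ℂ → ℂ} (hb : Continuous b) (h0 : ∀ w, b w ≠ 0) :
    ∃ h : Circle → ℂ, Continuous h ∧ ∀ z : Circle, Complex.exp (h z) = b z := by
  let H : C(I × Circle, {z : ℂ // z ≠ 0}) :=
    ⟨fun x => ⟨b (((x.1 : ℝ) : ℂ) * x.2), h0 _⟩, by
      refine Continuous.subtype_mk (hb.comp ?_) _
      fun_prop⟩
  have hH0 : ∀ a, H (0, a) = (⟨_, (Complex.log (b 0)).exp_ne_zero⟩ : {z : ℂ // z ≠ 0}) := by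
    intro a
    refine Subtype.ext ?_
    change b (((0 : ℝ) : ℂ) * a) = _
    simp [Complex.exp_log (h0 0)]
  -- The radial homotopy `b (t * z)` starts at the constant `b 0`, so its lift through `exp` can
  -- start at the constant `log (b 0)`; time 1 is the circle.
  let G := Complex.isCoveringMap_exp.liftHomotopy H (ContinuousMap.const _ (Complex.log (b 0))) hH0
  refine ⟨fun z => G (1, z), by fun_prop, fun z => ?_⟩
  have := congrFun (Complex.isCoveringMap_exp.liftHomotopy_lifts H
    (ContinuousMap.const _ (Complex.log (b 0))) hH0) (1, z)
  refine (congrArg Subtype.val this).trans ?_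
  change b (((1 : ℝ) : ℂ) * z) = _
  simp

/-- The identity of the circle has no continuous logarithm. -/
lemma no_log_circle {h : Circle → ℂ} (hc : Continuous h)
    (hh : ∀ z : Circle, Complex.exp (h z) = z) : False := by
  have hd : Continuous fun θ : ℝ => h (Circle.exp θ) - θ * Complex.I := by fun_prop
  have key : ∀ θ : ℝ, ∃ n : ℤ, h (Circle.exp θ) - θ * Complex.I = n * (2 * Real.pi * Complex.I) := by
    intro θ
    refine Complex.exp_eq_one_iff.1 ?_
    rw [Complex.exp_sub, hh, Circle.coe_exp, div_self (Complex.exp_ne_zero _)]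
  choose n hn using key
  have hpi : (2 * Real.pi * Complex.I : ℂ) ≠ 0 := Complex.two_pi_I_ne_zero
  have hnc : Continuous fun θ : ℝ => (n θ : ℝ) := by
    have h1 : (fun θ : ℝ => (n θ : ℝ)) =
        fun θ : ℝ => ((h (Circle.exp θ) - θ * Complex.I) / (2 * Real.pi * Complex.I)).re := by
      funext θ
      rw [hn, mul_div_assoc, div_self hpi]
      simp
    rw [h1]
    exact Complex.continuous_re.comp (hd.div_const _)
  have hnc' : Continuous n := Int.isClosedEmbedding_coe_real.continuous_iff.2 hnc
  -- The integer `n` is constant, yet `h` takes the same value at the parameters 0 and 2π while `θ *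
  -- I` changes by 2πi.
  have e : n 0 = n (2 * Real.pi) := PreconnectedSpace.constant inferInstance hnc'
  have h3 := hn (2 * Real.pi)
  rw [← e, ← hn 0, Circle.exp_two_pi] at h3
  simp only [Circle.exp_zero, Complex.ofReal_zero, zero_mul, sub_zero] at h3
  apply hpi
  exact_mod_cast sub_eq_self.1 h3

/-- Two nonvanishing functions on the plane cannot differ by the factor `-w` on the circle. -/
lemma no_clutching_complex {a b : ℂ → ℂ} (ha : Continuous a) (hb : Continuous b)
    (ha0 : ∀ w, a w ≠ 0) (hb0 : ∀ w, b w ≠ 0)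
    (hab : ∀ w : ℂ, ‖w‖ = 1 → a w = -(w * b w)) : False := by
  obtain ⟨f, hf, hfa⟩ := exists_log_circle ha.neg fun w => neg_ne_zero.2 (ha0 w)
  obtain ⟨g, hg, hgb⟩ := exists_log_circle hb hb0
  refine no_log_circle (hf.sub hg) fun z => ?_
  rw [Pi.sub_apply, Complex.exp_sub, hfa, hgb, Pi.neg_apply, hab z (Circle.norm_coe z), neg_neg,
    mul_div_assoc, div_self (hb0 z), mul_one]

/-- Two nonvanishing functions on the line cannot differ by the factor `-w` at `w = ±1`. -/
lemma no_clutching_real {a b : ℝ → ℝ} (ha : Continuous a) (hb : Continuous b)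
    (ha0 : ∀ w, a w ≠ 0) (hb0 : ∀ w, b w ≠ 0)
    (hab : ∀ w : ℝ, ‖w‖ = 1 → a w = -(w * b w)) : False := by
  have key : ∀ c : ℝ → ℝ, Continuous c → (∀ w, c w ≠ 0) → 0 < c (-1) * c 1 := by
    intro c hc h0
    by_contra! hneg
    have h1 : (0 : ℝ) ∈ Set.uIcc (c (-1)) (c 1) := by
      rw [Set.mem_uIcc]
      rcases mul_nonpos_iff.1 hneg with h | h
      · exact Or.inr ⟨h.2, h.1⟩
      · exact Or.inl h
    obtain ⟨w, -, hw0⟩ := intermediate_value_uIcc hc.continuousOn h1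
    exact h0 w hw0
  have h1 := key a ha ha0
  have h2 := key b hb hb0
  -- The factor `-w` reverses the sign at 1 and keeps it at -1, so exactly one of `a` and `b` would
  -- change sign on the line.
  rw [hab 1 (by simp), hab (-1) (by simp)] at h1
  linarith

/-! ### Lines in a Hilbert space -/

/-- The Hilbert space of square summable sequences. -/
abbrev Ell2 (𝕜 : Type) [RCLike 𝕜] : Type := lp (fun _ : ℕ => 𝕜) 2

/-- A polynomial as the sequence of its coefficients. -/
def coeffSeq (𝕜 : Type) [RCLike 𝕜] : 𝕜[X] →ₗ[𝕜] Ell2 𝕜 where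
  toFun f := ⟨fun n => f.coeff n, by
    refine Memℓp.of_exponent_ge (E := fun _ : ℕ => 𝕜) (q := 0) (memℓp_zero ?_) (by simp)
    refine f.support.finite_toSet.subset fun n hn => ?_
    simpa using hn⟩
  map_add' f g := by ext n; exact Polynomial.coeff_add f g n
  map_smul' c f := by ext n; exact Polynomial.coeff_smul c f n

lemma coeffSeq_apply {𝕜 : Type} [RCLike 𝕜] (f : 𝕜[X]) (n : ℕ) : coeffSeq 𝕜 f n = f.coeff n := rfl

lemma coeffSeq_ne_zero {𝕜 : Type} [RCLike 𝕜] {f : 𝕜[X]} (hf : f ≠ 0) : coeffSeq 𝕜 f ≠ 0 := by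
  intro h
  apply hf
  ext n
  rw [← coeffSeq_apply, h]
  rfl

section Lines

variable {𝕜 V : Type} [RCLike 𝕜] [NormedAddCommGroup V] [InnerProductSpace 𝕜 V]

/-- The orthogonal projection to the line spanned by `v`. -/
def lineProj (v : V) : V →L[𝕜] V :=
  ((‖v‖ ^ 2 : ℝ) : 𝕜)⁻¹ • (innerSL 𝕜 v).smulRight v

lemma lineProj_apply (v w : V) :
    lineProj (𝕜 := 𝕜) v w = (((‖v‖ ^ 2 : ℝ) : 𝕜)⁻¹ * inner 𝕜 v w) • v := by
  simp [lineProj, smul_smul]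

lemma lineProj_self (v : V) : lineProj (𝕜 := 𝕜) v v = v := by
  rcases eq_or_ne v 0 with rfl | hv
  · simp
  rw [lineProj_apply, inner_self_eq_norm_sq_to_K, RCLike.ofReal_pow, inv_mul_cancel₀, one_smul]
  simpa using hv

lemma lineProj_idem (v w : V) :
    lineProj (𝕜 := 𝕜) v (lineProj (𝕜 := 𝕜) v w) = lineProj (𝕜 := 𝕜) v w := by
  rw [lineProj_apply v w, map_smul, lineProj_self]

/-- The factor `‖c‖ ^ 2` from the two occurrences of `v` cancels against the normalisation; this is
why the projection descends to projective space. -/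
lemma lineProj_smul {c : 𝕜} (hc : c ≠ 0) (v : V) :
    lineProj (𝕜 := 𝕜) (c • v) = lineProj (𝕜 := 𝕜) v := by
  ext w
  have h : (‖c‖ : 𝕜) ≠ 0 := by simpa using hc
  simp only [lineProj_apply, norm_smul, inner_smul_left, smul_smul]
  congr 1
  push_cast
  rw [mul_pow, ← RCLike.conj_mul c, mul_inv, mul_inv]
  have h2 : (starRingEnd 𝕜) c ≠ 0 := by simpa using hc
  field_simp

lemma continuous_lineProj : Continuous fun v : {v : V // v ≠ 0} => lineProj (𝕜 := 𝕜) v.1 := by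
  unfold lineProj
  refine Continuous.smul (M := 𝕜) (X := V →L[𝕜] V) ?_ ?_
  · refine Continuous.inv₀ (by fun_prop) fun v => ?_
    simpa using v.2
  · have : Continuous fun v : V => (ContinuousLinearMap.smulRightL 𝕜 V V (innerSL 𝕜 v)) v := by
      fun_prop
    exact this.comp continuous_subtype_val

/-- Nonvanishing sections of line bundles can be moved along homotopies. -/
lemma exists_section_of_path {S : Type} [TopologicalSpace S] [CompactSpace S]
    (Q : C(I, C(S, V →L[𝕜] V))) (hQ : ∀ t x v, Q t x (Q t x v) = Q t x v)
    (h0 : ∃ s : C(S, V), ∀ x, s x ≠ 0 ∧ Q 0 x (s x) = s x) :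
    ∃ s : C(S, V), ∀ x, s x ≠ 0 ∧ Q 1 x (s x) = s x := by
  let T : Set I := {t | ∃ s : C(S, V), ∀ x, s x ≠ 0 ∧ Q t x (s x) = s x}
  -- The old section is projected to the new lines. Were the projection zero at `x`, then `Q t x - Q
  -- t' x` would fix the nonzero vector `s x`, although its norm is below 1.
  have step : ∀ t t', dist (Q t) (Q t') < 1 → t ∈ T → t' ∈ T := by
    rintro t t' hd ⟨s, hs⟩
    refine ⟨⟨fun x => Q t' x (s x), by fun_prop⟩, fun x => ⟨fun h => ?_, hQ _ _ _⟩⟩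
    change Q t' x (s x) = 0 at h
    have h1 : ‖Q t x - Q t' x‖ < 1 := by
      rw [← dist_eq_norm]
      exact (ContinuousMap.dist_apply_le_dist x).trans_lt hd
    have h2 : (Q t x - Q t' x) (s x) = s x := by
      simp [h, (hs x).2]
    have h3 := (Q t x - Q t' x).le_opNorm (s x)
    rw [h2] at h3
    have h4 : 0 < ‖s x‖ := norm_pos_iff.2 (hs x).1
    nlinarith
  have hnear : ∀ t, ∀ᶠ t' in 𝓝 t, dist (Q t) (Q t') < 1 := by
    intro t
    have : Continuous fun t' => dist (Q t) (Q t') := by fun_prop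
    have h := this.tendsto t
    simp only [dist_self] at h
    exact h.eventually (gt_mem_nhds one_pos)
  have hT : IsClopen T := by
    refine ⟨⟨isOpen_iff_mem_nhds.2 fun t ht => ?_⟩, isOpen_iff_mem_nhds.2 fun t ht => ?_⟩
    · filter_upwards [hnear t] with t' h ht'
      exact ht (step t' t (by rwa [dist_comm]) ht')
    · filter_upwards [hnear t] with t' h
      exact step t t' h ht
  have h1 : (1 : I) ∈ T := hT.eq_univ ⟨0, h0⟩ ▸ Set.mem_univ (1 : I)
  exact h1

end Lines

variable {𝕜 : Type} [RCLike 𝕜]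

/-! ### Line bundles pulled back from the infinite projective space -/

/-- The projection to a line of polynomials. -/
def PInf.proj (x : PInf 𝕜) : Ell2 𝕜 →L[𝕜] Ell2 𝕜 :=
  lineProj (coeffSeq 𝕜 (Projectivization.rep x))

lemma PInf.proj_mk (f : 𝕜[X]) (hf : f ≠ 0) :
    (PInf.mk f hf).proj = lineProj (coeffSeq 𝕜 f) := by
  obtain ⟨a, ha⟩ := Projectivization.exists_smul_eq_mk_rep 𝕜 f hf
  change lineProj (coeffSeq 𝕜 (Projectivization.mk 𝕜 f hf).rep) = _
  rw [← ha, Units.smul_def, map_smul, lineProj_smul a.ne_zero]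

lemma PInf.continuous_ofVec (m : ℕ) : Continuous (PInf.ofVec (𝕜 := 𝕜) m) :=
  continuous_iff_coinduced_le.2 (le_iSup (fun m : ℕ =>
    TopologicalSpace.coinduced (PInf.ofVec (𝕜 := 𝕜) m) inferInstance) m)

lemma PInf.continuous_dom {Y : Type} [TopologicalSpace Y] {f : PInf 𝕜 → Y}
    (h : ∀ m, Continuous (f ∘ PInf.ofVec m)) : Continuous f :=
  continuous_iSup_dom.2 fun m => continuous_coinduced_dom.2 (h m)

/-- The colimit topology reduces this to finitely many coefficients, where the linear map to the
sequence space is automatically continuous. -/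
lemma PInf.continuous_proj : Continuous (PInf.proj (𝕜 := 𝕜)) := by
  refine PInf.continuous_dom fun m => ?_
  have h1 : Continuous ((coeffSeq 𝕜).comp (Polynomial.ofFn (R := 𝕜) m)) :=
    LinearMap.continuous_of_finiteDimensional _
  have h2 : Continuous fun v : {v : Fin m → 𝕜 // v ≠ 0} =>
      (⟨coeffSeq 𝕜 (Polynomial.ofFn m v.1), coeffSeq_ne_zero (ofFn_ne_zero v.2)⟩ :
        {v : Ell2 𝕜 // v ≠ 0}) :=
    Continuous.subtype_mk (h1.comp continuous_subtype_val) _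
  refine ((continuous_lineProj (𝕜 := 𝕜)).comp h2).congr fun v => ?_
  exact (PInf.proj_mk _ _).symm

/-- The line bundle pulled back along a nullhomotopic map has a nonvanishing section. -/
lemma exists_section_of_nullhomotopic {S : Type} [TopologicalSpace S] [CompactSpace S]
    {f : C(S, PInf 𝕜)} (hf : f.Nullhomotopic) :
    ∃ s : C(S, Ell2 𝕜), ∀ x, s x ≠ 0 ∧ (f x).proj (s x) = s x := by
  obtain ⟨y, ⟨H⟩⟩ := hf
  let P : C(PInf 𝕜, Ell2 𝕜 →L[𝕜] Ell2 𝕜) := ⟨PInf.proj, PInf.continuous_proj⟩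
  let Q : C(I, C(S, Ell2 𝕜 →L[𝕜] Ell2 𝕜)) := (P.comp H.symm.toContinuousMap).curry
  have hQ : ∀ t x, Q t x = (H.symm (t, x)).proj := fun _ _ => rfl
  obtain ⟨s, hs⟩ := exists_section_of_path Q (fun t x v => by
      rw [hQ]; exact lineProj_idem _ _)
    ⟨ContinuousMap.const _ (coeffSeq 𝕜 (Projectivization.rep y)), fun x =>
      ⟨coeffSeq_ne_zero (Projectivization.rep_nonzero y), by
        rw [hQ, H.symm.apply_zero]; exact lineProj_self _⟩⟩
  refine ⟨s, fun x => ⟨(hs x).1, ?_⟩⟩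
  rw [← H.symm.apply_one x, ← hQ]
  exact (hs x).2

/-! ### The Hopf map in charts -/

lemma ofFn_two (a b : 𝕜) :
    Polynomial.ofFn 2 ![a, b] = Polynomial.C b * Polynomial.X + Polynomial.C a := by
  classical
  ext n
  rcases n with _ | _ | n
  · simp
  · simp [Polynomial.coeff_C]
  · rw [Polynomial.ofFn_coeff_eq_zero_of_ge _ (by omega)]
    simp

/-- Homogeneous coordinates of the two charts of stereographic projection, for the point with
horizontal component `u` and height `h`. -/
def IsStereo {S : Type} (u : S → 𝕜) (h : S → ℝ) (τ : S → PInf 𝕜) : Prop :=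
  ∀ x, (∀ hv : ![-u x, 1 - (h x : 𝕜)] ≠ 0, τ x = PInf.ofVec 2 ⟨_, hv⟩) ∧
    ∀ hv : ![-(1 + (h x : 𝕜)), starRingEnd 𝕜 (u x)] ≠ 0, τ x = PInf.ofVec 2 ⟨_, hv⟩

lemma one_sub_ofReal_ne_zero {r : ℝ} (hr : r ≠ 1) : 1 - (r : 𝕜) ≠ 0 := by
  rw [sub_ne_zero]
  exact_mod_cast hr.symm

lemma one_add_ofReal_ne_zero {r : ℝ} (hr : r ≠ -1) : 1 + (r : 𝕜) ≠ 0 := by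
  intro h
  have : (1 : 𝕜) + (r : 𝕜) = ((1 + r : ℝ) : 𝕜) := by push_cast; rfl
  rw [this, RCLike.ofReal_eq_zero] at h
  exact hr (by linarith)

lemma lower_ne_zero {u : 𝕜} {r : ℝ} (hr : r ≠ 1) : ![-u, 1 - (r : 𝕜)] ≠ 0 := fun h =>
  one_sub_ofReal_ne_zero hr (by simpa using congrFun h 1)

lemma upper_ne_zero {u : 𝕜} {r : ℝ} (hr : r ≠ -1) :
    ![-(1 + (r : 𝕜)), starRingEnd 𝕜 u] ≠ 0 := fun h =>
  one_add_ofReal_ne_zero hr (neg_eq_zero.1 (congrFun h 0))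

lemma continuousAt_ofVec {S : Type} [TopologicalSpace S] {m : ℕ} {v : S → Fin m → 𝕜}
    (hv : Continuous v) {τ : S → PInf 𝕜} (h : ∀ x, ∀ h0 : v x ≠ 0, τ x = PInf.ofVec m ⟨v x, h0⟩)
    {x : S} (hx : v x ≠ 0) : ContinuousAt τ x := by
  have ho : IsOpen {y | v y ≠ 0} := isOpen_ne_fun hv continuous_const
  have hc : ContinuousOn τ {y | v y ≠ 0} := by
    rw [continuousOn_iff_continuous_domRestrict]
    have : Continuous fun y : {y | v y ≠ 0} => PInf.ofVec m ⟨v y, y.2⟩ :=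
      (PInf.continuous_ofVec m).comp
        (Continuous.subtype_mk (hv.comp continuous_subtype_val) _)
    exact this.congr fun y => (h y.1 y.2).symm
  exact hc.continuousAt (ho.mem_nhds hx)

/-- The first chart is valid away from height 1 and the second near height 1, so together they cover
`S`. -/
lemma IsStereo.continuous {S : Type} [TopologicalSpace S] {u : S → 𝕜} {h : S → ℝ}
    {τ : S → PInf 𝕜} (hτ : IsStereo u h τ) (hu : Continuous u) (hh : Continuous h) :
    Continuous τ := by
  have hh' : Continuous fun x => (h x : 𝕜) := RCLike.continuous_ofReal.comp hh
  refine continuous_iff_continuousAt.2 fun x => ?_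
  by_cases hx : h x = 1
  · refine continuousAt_ofVec (v := fun x => ![-(1 + (h x : 𝕜)), starRingEnd 𝕜 (u x)]) ?_
      (fun x => (hτ x).2) (upper_ne_zero (by rw [hx]; norm_num))
    refine continuous_pi fun i => ?_
    fin_cases i
    · exact (continuous_const.add hh').neg
    · exact RCLike.continuous_conj.comp hu
  · refine continuousAt_ofVec (v := fun x => ![-u x, 1 - (h x : 𝕜)]) ?_
      (fun x => (hτ x).1) (lower_ne_zero hx)
    refine continuous_pi fun i => ?_
    fin_cases i
    · exact hu.neg
    · exact continuous_const.sub hh'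

/-- The clutching function of the line bundle over a sphere pulled back along a nullhomotopic
stereographic projection. -/
lemma IsStereo.exists_clutching {S : Type} [TopologicalSpace S] [CompactSpace S] {u : S → 𝕜}
    {h : S → ℝ} {τ : C(S, PInf 𝕜)} (hτ : IsStereo u h τ) (hnull : τ.Nullhomotopic)
    {lower upper : 𝕜 → S} (hl : Continuous lower) (hu : Continuous upper)
    (hl1 : ∀ w, h (lower w) ≠ 1) (hu1 : ∀ w, h (upper w) ≠ -1)
    (heq : ∀ w, ‖w‖ = 1 → lower w = upper w ∧ u (lower w) = w ∧ h (lower w) = 0) :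
    ∃ a b : 𝕜 → 𝕜, Continuous a ∧ Continuous b ∧ (∀ w, a w ≠ 0) ∧ (∀ w, b w ≠ 0) ∧
      ∀ w, ‖w‖ = 1 → a w = -(w * b w) := by
  obtain ⟨s, hs⟩ := exists_section_of_nullhomotopic hnull
  let e (n : ℕ) : Ell2 𝕜 →L[𝕜] 𝕜 := lp.evalCLM 𝕜 (fun _ : ℕ => 𝕜) 2 n
  -- The section at `x` lies on the line spanned by any chart vector `v`, hence is a nonzero
  -- multiple of it; only the coefficients 0 and 1 are needed.
  have key : ∀ x (v : Fin 2 → 𝕜) (hv : v ≠ 0), τ x = PInf.ofVec 2 ⟨v, hv⟩ →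
      ∃ c : 𝕜, c ≠ 0 ∧ e 0 (s x) = c * v 0 ∧ e 1 (s x) = c * v 1 := by
    classical
    intro x v hv hx
    have h1 := (hs x).2
    rw [hx, PInf.ofVec, PInf.proj_mk, lineProj_apply] at h1
    have h2 : ∀ n : Fin 2, e n (coeffSeq 𝕜 (Polynomial.ofFn 2 v)) = v n := fun n =>
      Polynomial.ofFn_coeff_eq_val_of_lt _ n.2
    generalize (_ : 𝕜) * _ = c at h1
    refine ⟨c, fun h0 => (hs x).1 ?_, ?_, ?_⟩
    · rw [← h1, h0, zero_smul]
    · rw [← h1, map_smul, smul_eq_mul]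
      exact congrArg (c * ·) (h2 0)
    · rw [← h1, map_smul, smul_eq_mul]
      exact congrArg (c * ·) (h2 1)
  -- In each chart the coordinate chosen is the one whose entry, `-(1 + h)` or `1 - h`, cannot
  -- vanish there. On the equator the section is `c * (-w, 1)`, which gives the factor `-w`.
  refine ⟨fun w => e 0 (s (upper w)), fun w => e 1 (s (lower w)), by fun_prop, by fun_prop,
    fun w => ?_, fun w => ?_, fun w hw => ?_⟩
  · have hv := upper_ne_zero (u := u (upper w)) (hu1 w)
    obtain ⟨c, hc, h0, -⟩ := key _ _ hv ((hτ _).2 hv)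
    simp only [h0]
    exact mul_ne_zero hc (neg_ne_zero.2 (one_add_ofReal_ne_zero (hu1 w)))
  · have hv := lower_ne_zero (u := u (lower w)) (hl1 w)
    obtain ⟨c, hc, -, h1⟩ := key _ _ hv ((hτ _).1 hv)
    simp only [h1]
    exact mul_ne_zero hc (one_sub_ofReal_ne_zero (hl1 w))
  · obtain ⟨he, hw1, hw2⟩ := heq w hw
    have hv := lower_ne_zero (u := u (lower w)) (hl1 w)
    obtain ⟨c, hc, h0, h1⟩ := key _ _ hv ((hτ _).1 hv)
    simp only [← he, h0, h1]
    simp only [hw1, hw2, Matrix.cons_val_zero, Matrix.cons_val_one]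
    simp [mul_comm]

/-- Proportional linear polynomials have the same class. -/
lemma PInf.mk_eq_ofVec {f : 𝕜[X]} (hf : f ≠ 0) {a b : 𝕜} (hv : ![a, b] ≠ 0) {c : 𝕜} (hc : c ≠ 0)
    (h : c • f = Polynomial.C b * Polynomial.X + Polynomial.C a) :
    PInf.mk f hf = PInf.ofVec 2 ⟨_, hv⟩ := by
  refine ((Projectivization.mk_eq_mk_iff 𝕜 _ _ _ _).2 ⟨Units.mk0 c hc, ?_⟩).symm
  rw [ofFn_two, ← h]
  rfl

/-- The chart formulas, from the affine formula for stereographic projection. -/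
lemma isStereo_of_eq {S : Type} {u : S → 𝕜} {h : S → ℝ} {τ : S → PInf 𝕜}
    (hS : ∀ x, starRingEnd 𝕜 (u x) * u x = (1 + (h x : 𝕜)) * (1 - (h x : 𝕜)))
    (h1 : ∀ x, h x = 1 → τ x = 1)
    (h2 : ∀ x, h x ≠ 1 → τ x = PInf.mk (Polynomial.X - Polynomial.C (u x / (1 - (h x : 𝕜))))
      (Polynomial.X_sub_C_ne_zero _)) : IsStereo u h τ := by
  refine fun x => ⟨fun hv => ?_, fun hv => ?_⟩
  -- At height 1 the sphere equation forces `u x = 0`, and the chart vector would vanish.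
  · have hx : h x ≠ 1 := by
      intro hx
      have hux := hS x
      simp only [hx, RCLike.ofReal_one, sub_self, mul_zero, mul_eq_zero, map_eq_zero, or_self] at hux
      exact hv (by simp [hx, hux])
    have hx' := one_sub_ofReal_ne_zero (𝕜 := 𝕜) hx
    rw [h2 x hx]
    refine PInf.mk_eq_ofVec _ hv hx' ?_
    rw [Polynomial.smul_eq_C_mul, mul_sub, ← Polynomial.C_mul, mul_div_cancel₀ _ hx', map_neg,
      sub_eq_add_neg]
  · by_cases hx : h x = 1
    · have hux := hS x
      simp only [hx, RCLike.ofReal_one, sub_self, mul_zero, mul_eq_zero, map_eq_zero, or_self] at hux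
      rw [h1 x hx, PInf.one_def]
      refine PInf.mk_eq_ofVec (c := -(1 + (h x : 𝕜))) _ hv
        (neg_ne_zero.2 (one_add_ofReal_ne_zero (by rw [hx]; norm_num))) ?_
      rw [hux, map_zero, map_zero, zero_mul, zero_add, Polynomial.smul_eq_C_mul, mul_one]
    · have hx' := one_sub_ofReal_ne_zero (𝕜 := 𝕜) hx
      -- The conjugate of `u x` is the factor taking the affine formula to the second chart. If it
      -- vanished below height 1, the sphere equation would give `1 + h x = 0`, and the chart vector
      -- would be zero.
      have hc : starRingEnd 𝕜 (u x) ≠ 0 := by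
        intro hux
        have := hS x
        rw [hux, zero_mul, eq_comm, mul_eq_zero, or_iff_left hx'] at this
        exact hv (by simp [hux, this])
      rw [h2 x hx]
      refine PInf.mk_eq_ofVec _ hv hc ?_
      rw [Polynomial.smul_eq_C_mul, mul_sub, ← Polynomial.C_mul, mul_div_assoc', hS x,
        mul_div_assoc, div_self hx', mul_one, map_neg, sub_eq_add_neg]

/-! ### Stereographic projection on the unit spheres -/

/-- The unit sphere of `ℝ^d`. -/
abbrev USphere (d : ℕ) : Type := Metric.sphere (0 : E d) 1

lemma sq_sum_sphere_three (p : USphere 3) : p.1 0 ^ 2 + p.1 1 ^ 2 + p.1 2 ^ 2 = 1 := by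
  have h := EuclideanSpace.norm_sq_eq p.1
  rw [norm_eq_of_mem_sphere p, Fin.sum_univ_three] at h
  simp only [Real.norm_eq_abs, sq_abs] at h
  linarith

lemma sq_sum_sphere_two (p : USphere 2) : p.1 0 ^ 2 + p.1 1 ^ 2 = 1 := by
  have h := EuclideanSpace.norm_sq_eq p.1
  rw [norm_eq_of_mem_sphere p, Fin.sum_univ_two] at h
  simp only [Real.norm_eq_abs, sq_abs] at h
  linarith

lemma isStereo_stereoC : IsStereo (fun p : USphere 3 => (p.1 0 : ℂ) + (p.1 1 : ℂ) * Complex.I)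
    (fun p => p.1 2) (fun p => stereoC (pad p.1)) := by
  refine isStereo_of_eq (fun p => ?_) (fun p hp => ?_) (fun p hp => ?_)
  · have h := sq_sum_sphere_three p
    apply Complex.ext
    · simp
      linarith
    · simp
      ring
  · exact if_pos hp
  · exact if_neg hp

lemma isStereo_stereoR : IsStereo (fun p : USphere 2 => p.1 0)
    (fun p => p.1 1) (fun p => stereoR (pad p.1)) := by
  refine isStereo_of_eq (fun p => ?_) (fun p hp => ?_) (fun p hp => ?_)
  · have h := sq_sum_sphere_two p
    simp
    linarith
  · exact if_pos hp
  · exact if_neg hp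

lemma continuous_stereoC : Continuous fun p : USphere 3 => stereoC (pad p.1) :=
  isStereo_stereoC.continuous (by fun_prop) (by fun_prop)

lemma continuous_stereoR : Continuous fun p : USphere 2 => stereoR (pad p.1) :=
  isStereo_stereoR.continuous (by fun_prop) (by fun_prop)

/-- Inverse stereographic projection to `S^2`, from the north pole for `ε = -1` and, up to
conjugation, from the south pole for `ε = 1`. -/
def invStereoC (ε : ℤˣ) (w : ℂ) : USphere 3 :=
  ⟨!₂[2 * w.re / (1 + ‖w‖ ^ 2), 2 * w.im / (1 + ‖w‖ ^ 2),
    ((ε : ℤ) : ℝ) * (1 - ‖w‖ ^ 2) / (1 + ‖w‖ ^ 2)], by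
    have h : 1 + ‖w‖ ^ 2 ≠ 0 := by positivity
    have h2 : ‖w‖ ^ 2 = w.re ^ 2 + w.im ^ 2 := by
      rw [← Complex.normSq_eq_norm_sq, Complex.normSq_apply]; ring
    have hε : ((ε : ℤ) : ℝ) ^ 2 = 1 := by
      rcases Int.units_eq_one_or ε with rfl | rfl <;> simp
    rw [mem_sphere_zero_iff_norm, EuclideanSpace.norm_eq, Real.sqrt_eq_one, Fin.sum_univ_three]
    simp only [Real.norm_eq_abs, sq_abs, Matrix.cons_val]
    simp only [div_pow, mul_pow, hε]
    field_simp
    rw [h2]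
    ring⟩

lemma continuous_invStereoC (ε : ℤˣ) : Continuous (invStereoC ε) := by
  have h : ∀ w : ℂ, 1 + ‖w‖ ^ 2 ≠ 0 := fun w => by positivity
  refine Continuous.subtype_mk ((PiLp.continuous_toLp 2 _).comp (continuous_pi fun i => ?_)) _
  fin_cases i
  · exact Continuous.div (by fun_prop) (by fun_prop) h
  · exact Continuous.div (by fun_prop) (by fun_prop) h
  · exact Continuous.div (by fun_prop) (by fun_prop) h

/-- Inverse stereographic projection to `S^1`. -/
def invStereoR (ε : ℤˣ) (w : ℝ) : USphere 2 :=
  ⟨!₂[2 * w / (1 + w ^ 2), ((ε : ℤ) : ℝ) * (1 - w ^ 2) / (1 + w ^ 2)], by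
    have h : 1 + w ^ 2 ≠ 0 := by positivity
    have hε : ((ε : ℤ) : ℝ) ^ 2 = 1 := by
      rcases Int.units_eq_one_or ε with rfl | rfl <;> simp
    rw [mem_sphere_zero_iff_norm, EuclideanSpace.norm_eq, Real.sqrt_eq_one, Fin.sum_univ_two]
    simp only [Real.norm_eq_abs, sq_abs, Matrix.cons_val]
    simp only [div_pow, mul_pow, hε]
    field_simp
    ring⟩

lemma continuous_invStereoR (ε : ℤˣ) : Continuous (invStereoR ε) := by
  have h : ∀ w : ℝ, 1 + w ^ 2 ≠ 0 := fun w => by positivity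
  refine Continuous.subtype_mk ((PiLp.continuous_toLp 2 _).comp (continuous_pi fun i => ?_)) _
  fin_cases i
  · exact Continuous.div (by fun_prop) (by fun_prop) h
  · exact Continuous.div (by fun_prop) (by fun_prop) h

/-- The inclusion `S^2 ≅ ℂP^1 ⊆ ℂP^∞` is essential. -/
lemma stereoC_not_nullhomotopic :
    ¬ (⟨_, continuous_stereoC⟩ : C(USphere 3, PInf ℂ)).Nullhomotopic := by
  intro hnull
  obtain ⟨a, b, ha, hb, ha0, hb0, hab⟩ := IsStereo.exists_clutching isStereo_stereoC hnull
    (continuous_invStereoC (-1)) (continuous_invStereoC 1)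
    (fun w h => by
      have h0 : 1 + ‖w‖ ^ 2 ≠ 0 := by positivity
      simp only [invStereoC, PiLp.toLp_apply, Matrix.cons_val] at h
      rw [div_eq_one_iff_eq h0] at h
      simp at h
      linarith)
    (fun w h => by
      have h0 : 1 + ‖w‖ ^ 2 ≠ 0 := by positivity
      simp only [invStereoC, PiLp.toLp_apply, Matrix.cons_val] at h
      rw [div_eq_iff h0] at h
      simp at h
      linarith)
    (fun w hw => by
      refine ⟨Subtype.ext ?_, ?_, ?_⟩
      · simp [invStereoC, hw]
      · simp only [invStereoC, hw, PiLp.toLp_apply, Matrix.cons_val]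
        norm_num
      · simp [invStereoC, hw])
  exact no_clutching_complex ha hb ha0 hb0 hab

/-- The inclusion `S^1 ≅ ℝP^1 ⊆ ℝP^∞` is essential. -/
lemma stereoR_not_nullhomotopic :
    ¬ (⟨_, continuous_stereoR⟩ : C(USphere 2, PInf ℝ)).Nullhomotopic := by
  intro hnull
  obtain ⟨a, b, ha, hb, ha0, hb0, hab⟩ := IsStereo.exists_clutching isStereo_stereoR hnull
    (continuous_invStereoR (-1)) (continuous_invStereoR 1)
    (fun w h => by
      have h0 : 1 + w ^ 2 ≠ 0 := by positivity
      simp only [invStereoR, PiLp.toLp_apply, Matrix.cons_val] at h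
      rw [div_eq_one_iff_eq h0] at h
      simp at h
      linarith)
    (fun w h => by
      have h0 : 1 + w ^ 2 ≠ 0 := by positivity
      simp only [invStereoR, PiLp.toLp_apply, Matrix.cons_val] at h
      rw [div_eq_iff h0] at h
      simp at h
      linarith)
    (fun w hw => by
      have hw2 : w ^ 2 = 1 := by rw [← sq_abs, ← Real.norm_eq_abs, hw, one_pow]
      refine ⟨Subtype.ext ?_, ?_, ?_⟩
      · simp [invStereoR, hw2]
      · simp [invStereoR, hw2]; ring
      · simp [invStereoR, hw2])
  exact no_clutching_real ha hb ha0 hb0 hab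

/-! ### Directions in the Fulton--MacPherson spaces -/

lemma closed_of_conf {d : ℕ} {ι : Type} {P : Coord ι → Prop} (hP : IsClosed {a | P a})
    (h : ∀ p : ι → E d, Function.Injective p → P (coords p)) {a : Coord ι}
    (ha : a ∈ closure (confSet d ι)) : P a := by
  refine closure_minimal (t := {a | P a}) ?_ hP ha
  rintro _ ⟨p, hp, rfl⟩
  exact h p hp

lemma pad_zero {d : ℕ} : pad (0 : E d) = 0 := by
  funext n
  simp [pad]

lemma pad_neg {d : ℕ} (v : E d) : pad (-v) = -pad v := by
  funext n
  by_cases h : n < d <;> simp [pad, h]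

lemma sum_sq_pad {d : ℕ} (v : E d) : ∑ n ∈ Finset.range d, pad v n ^ 2 = ‖v‖ ^ 2 := by
  rw [EuclideanSpace.norm_sq_eq, ← Fin.sum_univ_eq_sum_range]
  simp [pad]

lemma dir_self {d : ℕ} {ι : Type} {a : Coord ι} (ha : a ∈ closure (confSet d ι)) (i : ι) :
    a.1 i i = 0 := by
  refine closed_of_conf (P := fun a => a.1 i i = 0)
    (isClosed_eq (by fun_prop) continuous_const) (fun p _ => ?_) ha
  simp [coords, pad_zero]

/-- By the convention `0 / 0 = 0` in `ℝ≥0∞`, the degenerate coordinates are the same in every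
configuration, so inserting a single point does not alter them. -/
lemma ratio_self {d : ℕ} {ι : Type} {a : Coord ι} (ha : a ∈ closure (confSet d ι)) (i : ι) :
    a.2 i i i = 0 := by
  refine closed_of_conf (P := fun a => a.2 i i i = 0)
    (isClosed_eq (by fun_prop) continuous_const) (fun p _ => ?_) ha
  simp [coords]

lemma dir_swap {d : ℕ} {ι : Type} {a : Coord ι} (ha : a ∈ closure (confSet d ι)) (i j : ι) :
    a.1 j i = -a.1 i j := by
  refine closed_of_conf (P := fun a => a.1 j i = -a.1 i j)
    (isClosed_eq (by fun_prop) (by fun_prop)) (fun p _ => ?_) ha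
  simp only [coords]
  rw [← pad_neg, ← smul_neg, neg_sub, norm_sub_rev]

/-- Directions of configurations have unit length, and this is a closed condition because only the
first `d` coordinates enter. -/
lemma exists_dir_ne_zero {d : ℕ} {ι : Type} {a : Coord ι} (ha : a ∈ closure (confSet d ι))
    {i j : ι} (hij : i ≠ j) : ∃ n, a.1 i j n ≠ 0 := by
  have h : ∑ n ∈ Finset.range d, a.1 i j n ^ 2 = 1 := by
    refine closed_of_conf (P := fun a => ∑ n ∈ Finset.range d, a.1 i j n ^ 2 = 1)
      (isClosed_eq (by fun_prop) continuous_const) (fun p hp => ?_) ha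
    have hne : ‖p j - p i‖ ≠ 0 := norm_ne_zero_iff.2 (sub_ne_zero.2 (hp.ne hij.symm))
    simp only [coords]
    rw [sum_sq_pad, norm_smul, norm_inv, norm_norm, inv_mul_cancel₀ hne, one_pow]
  by_contra! h0
  simp [h0] at h

/-! ### The double cover of the quadratic extended power -/

lemma FM.continuous_toInf {d : ℕ} {ι : Type} : Continuous (FM.toInf : FM d ι → FMInf ι) :=
  continuous_iff_coinduced_le.2
    (le_iSup (fun d : ℕ => TopologicalSpace.coinduced (FM.toInf (d := d) (ι := ι)) inferInstance) d)

lemma FMInf.continuous_dom {ι Y : Type} [TopologicalSpace Y] {f : FMInf ι → Y}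
    (h : ∀ d, Continuous fun p : FM d ι => f p.toInf) : Continuous f :=
  continuous_iSup_dom.2 fun d => continuous_coinduced_dom.2 (h d)

lemma FMInf.continuous_val {ι : Type} : Continuous fun a : FMInf ι => a.1 :=
  FMInf.continuous_dom fun _ => continuous_subtype_val

lemma FMInf.continuous_reindex {ι κ : Type} (e : κ ≃ ι) :
    Continuous (FMInf.reindex e) := by
  refine FMInf.continuous_dom fun d => ?_
  have h : Continuous (FM.reindex e : FM d ι → FM d κ) :=
    Continuous.subtype_mk ((Coord.continuous_reindex e).comp continuous_subtype_val) _
  exact FM.continuous_toInf.comp h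

/-- The left action of the symmetric group on labelled configurations. -/
@[reducible] def permAction (𝕜 : Type) [RCLike 𝕜] (n : ℕ) :
    MulAction (Equiv.Perm (Fin n)) (FMInf (Fin n) × (Fin n → PInf 𝕜)) where
  smul g a := (a.1.reindex g.symm, a.2 ∘ g.symm)
  one_smul _ := rfl
  mul_smul _ _ _ := rfl

/-- The swap negates the direction from point 0 to point 1, which never vanishes. Fixing the sign of
one of its nonzero coordinates gives a neighbourhood disjoint from its swapped copy. -/
lemma isQuotientCoveringMap_D (𝕜 : Type) [RCLike 𝕜] :
    letI := permAction 𝕜 2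
    IsQuotientCoveringMap (Quotient.mk (orbitSetoid 𝕜 2)) (Equiv.Perm (Fin 2)) := by
  let := permAction 𝕜 2
  refine { isQuotientMap_quotient_mk' with
    continuous_const_smul := fun g => ?_
    apply_eq_iff_mem_orbit := fun {a b} => ?_
    disjoint := fun a => ?_ }
  · refine ((FMInf.continuous_reindex g.symm).comp continuous_fst).prodMk
      (continuous_pi fun i => ?_)
    exact (continuous_apply (g.symm i)).comp continuous_snd
  · rw [Quotient.eq]
    constructor
    · rintro ⟨g, rfl⟩
      refine ⟨g, Prod.ext (Subtype.ext ?_) ?_⟩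
      · change (a.1.1.reindex g).reindex g.symm = _
        simp [Coord.reindex]
      · change (a.2 ∘ g) ∘ g.symm = _
        funext i
        simp
    · rintro ⟨g, rfl⟩
      refine ⟨g, Prod.ext (Subtype.ext ?_) ?_⟩
      · change _ = (b.1.1.reindex g.symm).reindex g
        simp [Coord.reindex]
      · change _ = (b.2 ∘ g.symm) ∘ g
        funext i
        simp
  · obtain ⟨d, hd⟩ := a.1.2
    obtain ⟨m, hm⟩ := exists_dir_ne_zero hd (i := 0) (j := 1) (by decide)
    let c := a.1.1.1 0 1 m
    have hc : Continuous fun b : FMInf (Fin 2) × (Fin 2 → PInf 𝕜) => b.1.1.1 0 1 m * c := by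
      have := (FMInf.continuous_val (ι := Fin 2)).comp
        (continuous_fst (X := FMInf (Fin 2)) (Y := Fin 2 → PInf 𝕜))
      fun_prop
    refine ⟨{b | 0 < b.1.1.1 0 1 m * c}, (isOpen_lt continuous_const hc).mem_nhds
      (mul_self_pos.2 hm), fun g => ?_⟩
    rintro ⟨_, ⟨b, hb, rfl⟩, hb'⟩
    obtain ⟨e, he⟩ := b.1.2
    by_contra hg
    have hg' : g.symm = Equiv.swap 0 1 :=
      (by decide : ∀ g : Equiv.Perm (Fin 2), ¬g = 1 → g.symm = Equiv.swap 0 1) g hg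
    change 0 < b.1.1.1 (g.symm 0) (g.symm 1) m * c at hb'
    change 0 < b.1.1.1 0 1 m * c at hb
    rw [hg', Equiv.swap_apply_left, Equiv.swap_apply_right, dir_swap he 0 1, Pi.neg_apply,
      neg_mul] at hb'
    linarith

lemma isCoveringMap_D (𝕜 : Type) [RCLike 𝕜] :
    IsCoveringMap (Quotient.mk (orbitSetoid 𝕜 2)) := by
  let := permAction 𝕜 2
  exact (isQuotientCoveringMap_D 𝕜).isCoveringMap

/-- Nullhomotopies of maps from connected spaces lift along covering maps. -/
lemma _root_.IsCoveringMap.nullhomotopic_of_comp {X Y S : Type*} [TopologicalSpace X]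
    [TopologicalSpace Y] [TopologicalSpace S] [ConnectedSpace S] {π : C(X, Y)}
    (hπ : IsCoveringMap π) {f : C(S, X)} (h : (π.comp f).Nullhomotopic) : f.Nullhomotopic := by
  obtain ⟨y, ⟨H⟩⟩ := h
  have hH0 : ∀ s, H.toContinuousMap (0, s) = π (f s) := fun s => H.apply_zero s
  let G := hπ.liftHomotopy H.toContinuousMap f hH0
  have hG : ∀ z, π (G z) = H z := congrFun (hπ.liftHomotopy_lifts H.toContinuousMap f hH0)
  obtain ⟨s₀⟩ := (inferInstance : Nonempty S)
  refine ⟨G (1, s₀), ⟨⟨G, fun s => hπ.liftHomotopy_zero _ _ hH0 s, fun s => ?_⟩⟩⟩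
  -- The end of the lifted homotopy lies over a single point, so it is constant on the connected
  -- space `S`.
  refine hπ.const_of_comp (g := fun s => G (1, s)) (by fun_prop) (fun s s' => ?_) s s₀
  simp only [hG]
  exact (H.apply_one s).trans (H.apply_one s').symm

/-! ### The binary structure map at the base point -/

/-- The bijection forces `n = m` and becomes a permutation, which the orbit relation absorbs. It
removes the arity `∑ _ : Fin 2, 1` without casts. -/
lemma DTotal.mk_reindex {n m : ℕ} (e : Fin n ≃ Fin m) (a : FMInf (Fin m)) (x : Fin m → PInf 𝕜) :
    (⟨m, Quotient.mk _ (a, x)⟩ : DTotal 𝕜) = ⟨n, Quotient.mk _ (a.reindex e, x ∘ e)⟩ := by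
  obtain rfl : n = m := by simpa using Fintype.card_congr e
  exact congrArg (Sigma.mk n) (Quotient.sound ⟨e, rfl⟩)

/-- Two points labelled by their directions. -/
def dirLabel (τ : (ℕ → ℝ) → PInf 𝕜) {d : ℕ} (p : FM d (Fin 2)) :
    FMInf (Fin 2) × (Fin 2 → PInf 𝕜) :=
  (p.toInf, ![τ (p.1.1 0 1), τ (p.1.1 1 0)])

/-- Inserting one-point configurations changes nothing, and with two inputs of weight 1 each Atiyah
product has a single factor. -/
lemma nu_basePoint (τ : (ℕ → ℝ) → PInf 𝕜) {d : ℕ} (p : FM d (Fin 2)) :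
    nu τ p (fun _ => basePoint 𝕜) = ⟨2, Quotient.mk _ (dirLabel τ p)⟩ := by
  let r₀ : FM 1 (Fin 1) := FM.ofConf (fun _ => 0) (Function.injective_of_subsingleton _)
  let r : FMInf (Fin 1) × (Fin 1 → PInf 𝕜) :=
    (r₀.toInf, fun _ => 1)
  refine (nu_mk τ p (fun _ => 1) fun _ => r).trans ?_
  rw [nuMk]
  let e : Fin 2 ≃ Fin (∑ _ : Fin 2, 1) :=
    (Equiv.sigmaUnique (Fin 2) fun _ => Fin 1).symm.trans finSigmaFinEquiv
  have he : ∀ i : Fin 2, finSigmaFinEquiv.symm (e i) = ⟨i, 0⟩ := fun i =>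
    (Equiv.symm_apply_apply _ _).trans rfl
  rw [DTotal.mk_reindex e]
  refine congrArg (fun z => (⟨2, Quotient.mk (orbitSetoid 𝕜 2) z⟩ : DTotal 𝕜)) ?_
  refine Prod.ext (Subtype.ext (Prod.ext ?_ ?_)) ?_
  · funext i j
    simp only [FMInf.reindex, Coord.reindex, FMInf.comp, Coord.comp, he, dirLabel]
    -- Diagonal coordinates of the composite come from the inserted point instead of `p`; both are
    -- zero.
    by_cases h : j = i
    · subst h
      rw [dif_pos rfl]
      refine (dir_self r₀.2 0).trans ?_
      exact (dir_self p.2 j).symm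
    · rw [dif_neg h]
  · funext i j k
    simp only [FMInf.reindex, Coord.reindex, FMInf.comp, Coord.comp, he, dirLabel]
    by_cases h : j = i ∧ k = i
    · obtain ⟨rfl, rfl⟩ := h
      rw [dif_pos ⟨rfl, rfl⟩]
      refine (ratio_self r₀.2 0).trans ?_
      exact (ratio_self p.2 _).symm
    · rw [dif_neg h]
  · funext i
    simp only [Function.comp_apply, he, atiyah, pow_one, dirLabel]
    fin_cases i
    · exact (mul_one _).trans (Finset.prod_singleton (fun j => τ (p.1.1 0 j)) 1)
    · exact (mul_one _).trans (Finset.prod_singleton (fun j => τ (p.1.1 1 j)) 0)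

lemma dir_antipodal {d : ℕ} (p : USphere d) :
    (antipodal p).1.1 0 1 = pad (-p.1) ∧ (antipodal p).1.1 1 0 = pad p.1 := by
  have hp := norm_eq_of_mem_sphere p
  have h1 : -p.1 - p.1 = (2 : ℝ) • -p.1 := by rw [two_smul, sub_eq_add_neg]
  have h2 : p.1 - -p.1 = (2 : ℝ) • p.1 := by rw [two_smul, sub_neg_eq_add]
  constructor
  · change pad (‖-p.1 - p.1‖⁻¹ • (-p.1 - p.1)) = _
    rw [h1, norm_smul, norm_neg, hp, smul_smul]
    norm_num
  · change pad (‖p.1 - -p.1‖⁻¹ • (p.1 - -p.1)) = _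
    rw [h2, norm_smul, hp, smul_smul]
    norm_num

/-! ### Contracting antipodal pairs with one extra dimension -/

lemma pair_injective {d : ℕ} (q : {q : E d // q ≠ 0}) : Function.Injective ![q.1, -q.1] := by
  have h1 : q.1 ≠ -q.1 := fun h => q.2 <| by
    have h2 : (2 : ℝ) • q.1 = 0 := by
      rw [two_smul]
      exact add_eq_zero_iff_eq_neg.2 h
    simpa using h2
  intro i j h
  fin_cases i <;> fin_cases j <;> simp_all

/-- The configuration `(q, -q)` for a nonzero vector `q`. -/
def pairConf {d : ℕ} (q : {q : E d // q ≠ 0}) : FM d (Fin 2) :=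
  FM.ofConf ![q.1, -q.1] (pair_injective q)

lemma continuous_coords {d : ℕ} {ι Z : Type} [TopologicalSpace Z] {f : Z → ι → E d}
    (hf : Continuous f) (hinj : ∀ z, Function.Injective (f z)) :
    Continuous fun z => coords (f z) := by
  have hfi : ∀ i, Continuous fun z => f z i := fun i => (continuous_apply i).comp hf
  refine Continuous.prodMk ?_ ?_
  · refine continuous_pi fun i => continuous_pi fun j => ?_
    by_cases h : j = i
    · subst h
      simpa using continuous_const
    · have hsub := (hfi j).sub (hfi i)
      exact continuous_pad.comp ((hsub.norm.inv₀ fun z =>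
        norm_ne_zero_iff.2 (sub_ne_zero.2 ((hinj z).ne h))).smul hsub)
  · refine continuous_pi fun i => continuous_pi fun j => continuous_pi fun k => ?_
    by_cases hj : i = j
    · subst hj
      simpa using continuous_const
    · refine continuous_iff_continuousAt.2 fun z => ?_
      -- The quotient is continuous also for `k = i`, where it equals ∞: the numerator is positive
      -- and both distances are finite.
      exact ENNReal.Tendsto.div ((hfi i).edist (hfi j)).continuousAt
        (Or.inl (edist_pos.2 ((hinj z).ne hj)).ne') ((hfi i).edist (hfi k)).continuousAt
        (Or.inl (edist_ne_top _ _))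

lemma continuous_pairConf {d : ℕ} : Continuous (pairConf (d := d)) := by
  refine Continuous.subtype_mk (continuous_coords (continuous_pi fun i => ?_) pair_injective) _
  fin_cases i
  · exact continuous_subtype_val
  · exact continuous_subtype_val.neg

lemma continuous_antipodal {d : ℕ} : Continuous (antipodal (d := d)) := by
  refine Continuous.subtype_mk (continuous_coords (continuous_pi fun i => ?_)
    antipodal_injective) _
  fin_cases i
  · exact continuous_subtype_val
  · exact continuous_subtype_val.neg

lemma stab_neg {d e : ℕ} (v : E d) : stab e (-v) = -stab e v := by
  simpa using stab_smul (e := e) (-1) v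

lemma continuous_stab {d e : ℕ} : Continuous (stab e : E d → E e) := by
  refine (PiLp.continuous_toLp 2 _).comp (continuous_pi fun i => ?_)
  exact (continuous_apply (i : ℕ)).comp continuous_pad

lemma coords_stab {d e : ℕ} (h : d ≤ e) {ι : Type} (p : ι → E d) :
    coords (fun i => stab e (p i)) = coords p := by
  unfold coords
  simp only [edist_stab h, ← stab_sub, norm_stab h, ← stab_smul, pad_stab h]

lemma stab_ne_zero {d e : ℕ} (h : d ≤ e) {v : E d} (hv : v ≠ 0) : stab e v ≠ 0 := by
  rw [← norm_ne_zero_iff, norm_stab h]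
  exact norm_ne_zero_iff.2 hv

lemma incl_antipodal {d e : ℕ} (h : d ≤ e) (p : USphere d) :
    (antipodal p).incl h = pairConf ⟨stab e p.1, stab_ne_zero h (ne_zero_of_mem_unit_sphere p)⟩ := by
  refine Subtype.ext ?_
  change coords _ = coords _
  rw [← coords_stab h]
  congr 1
  funext i
  fin_cases i
  · rfl
  · exact stab_neg p.1

/-- Antipodal configurations, in one dimension more. -/
def suspAntipodal (d : ℕ) : C(USphere d, FM (d + 1) (Fin 2)) :=
  ⟨fun p => (antipodal p).incl d.le_succ, (FM.continuous_incl _).comp continuous_antipodal⟩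

/-- The segment from a point of the equatorial sphere to the new unit vector `v` misses the origin:
its last coordinate is the time, and at time 0 it sits on the sphere. The pairs `(q, -q)` along it
give the contraction. -/
lemma suspAntipodal_nullhomotopic (d : ℕ) : (suspAntipodal d).Nullhomotopic := by
  let v : E (d + 1) := EuclideanSpace.single (Fin.last d) 1
  let q : I × USphere d → E (d + 1) := fun z =>
    (1 - (z.1 : ℝ)) • stab (d + 1) z.2.1 + (z.1 : ℝ) • v
  have hv : v ≠ 0 := by simp [v]
  have hq0 : ∀ z, q z ≠ 0 := by
    intro z hz
    have hlast : q z (Fin.last d) = z.1 := by simp [q, v, stab, pad]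
    have h0 : (z.1 : ℝ) = 0 := by rw [← hlast, hz]; rfl
    have : stab (d + 1) z.2.1 = 0 := by simpa [q, h0] using hz
    exact stab_ne_zero d.le_succ (ne_zero_of_mem_unit_sphere z.2) this
  have hqc : Continuous q := by
    have := (continuous_stab (d := d) (e := d + 1)).comp
      (continuous_subtype_val.comp (continuous_snd (X := I) (Y := USphere d)))
    have h2 : Continuous fun z : I × USphere d => (z.1 : ℝ) := by fun_prop
    exact ((continuous_const.sub h2).smul this).add (h2.smul continuous_const)
  refine ⟨pairConf ⟨v, hv⟩, ⟨⟨⟨fun z => pairConf ⟨q z, hq0 z⟩,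
    continuous_pairConf.comp (Continuous.subtype_mk hqc _)⟩, fun p => ?_, fun p => ?_⟩⟩⟩
  · refine Eq.trans ?_ (incl_antipodal d.le_succ p).symm
    change pairConf _ = _
    congr 2
    simp [q]
  · change pairConf _ = pairConf _
    congr 2
    simp [q]

/-! ### The structure map on antipodal configurations is essential -/

/-- The class of the antipodal configurations labelled by their directions. -/
def antipodalClass (τ : (ℕ → ℝ) → PInf 𝕜) {d : ℕ} (hτ : Continuous fun p : USphere d => τ (pad p.1)) :
    C(USphere d, FMInf (Fin 2) × (Fin 2 → PInf 𝕜)) :=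
  ⟨fun p => dirLabel τ (antipodal p), by
    refine (FM.continuous_toInf.comp continuous_antipodal).prodMk (continuous_pi fun i => ?_)
    fin_cases i
    · refine (hτ.comp continuous_neg).congr fun p => ?_
      exact congrArg τ (dir_antipodal p).1.symm
    · exact hτ.congr fun p => congrArg τ (dir_antipodal p).2.symm⟩

/-- The orbit map, as a continuous map. -/
def orbitMap (𝕜 : Type) [RCLike 𝕜] (n : ℕ) : C(FMInf (Fin n) × (Fin n → PInf 𝕜), D 𝕜 n) :=
  ⟨Quotient.mk _, continuous_quotient_mk'⟩

lemma connectedSpace_USphere {d : ℕ} (hd : 2 ≤ d) : ConnectedSpace (USphere d) := by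
  refine isConnected_iff_connectedSpace.1 (isConnected_sphere ?_ _ zero_le_one)
  rw [← Module.finrank_eq_rank, finrank_euclideanSpace_fin]
  exact_mod_cast hd

/-- A nullhomotopy lifts through the double covering, and the label of point 1 in `(p, -p)` is `τ`
of the direction `p` itself. -/
lemma antipodalClass_not_nullhomotopic {τ : (ℕ → ℝ) → PInf 𝕜} {d : ℕ} (hd : 2 ≤ d)
    {hτ : Continuous fun p : USphere d => τ (pad p.1)}
    (hnull : ¬ (⟨_, hτ⟩ : C(USphere d, PInf 𝕜)).Nullhomotopic) :
    ¬ ((orbitMap 𝕜 2).comp (antipodalClass τ hτ)).Nullhomotopic := by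
  intro h
  have := connectedSpace_USphere hd
  have h1 := (IsCoveringMap.nullhomotopic_of_comp (π := orbitMap 𝕜 2)
    (isCoveringMap_D 𝕜) h).comp_right
    ⟨fun z => z.2 1, (continuous_apply (1 : Fin 2)).comp continuous_snd⟩
  refine hnull ?_
  convert h1 using 1
  ext p
  exact congrArg τ (dir_antipodal p).2.symm

/-- The structure map at the base point does not extend to one dimension more. -/
lemma no_extension {τ : (ℕ → ℝ) → PInf 𝕜} {d : ℕ} (hd : 2 ≤ d)
    {hτ : Continuous fun p : USphere d => τ (pad p.1)}
    (hnull : ¬ (⟨_, hτ⟩ : C(USphere d, PInf 𝕜)).Nullhomotopic)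
    (g : C(FM (d + 1) (Fin 2), D 𝕜 2))
    (hg : ∀ p : FM d (Fin 2), (⟨2, g (p.incl d.le_succ)⟩ : DTotal 𝕜) =
      nu τ p fun _ => basePoint 𝕜) : False := by
  refine antipodalClass_not_nullhomotopic hd hnull ?_
  convert (suspAntipodal_nullhomotopic d).comp_right g using 1
  ext p
  have h := hg (antipodal p)
  rw [nu_basePoint] at h
  exact (eq_of_heq (Sigma.mk.inj h).2).symm

/-! ### Passage to the flag spaces -/

/-- The base point, as a flag in dimension one. -/
def baseFlag (𝕜 : Type) [RCLike 𝕜] : FlagTotal 𝕜 :=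
  ⟨basePoint 𝕜, _, fun _ => (1 : PInf 𝕜), rfl, fun _ => by
    rw [PInf.one_def, PInf.mk, Projectivization.submodule_mk, Submodule.span_singleton_le_iff_mem,
      Polynomial.mem_degreeLT, Polynomial.degree_one]
    exact_mod_cast one_pos, by
    refine Projectivization.independent_iff.2 ?_
    have : Subsingleton (Fin (basePoint 𝕜).1) := inferInstanceAs (Subsingleton (Fin 1))
    exact LinearIndependent.of_subsingleton (0 : Fin 1) (Projectivization.rep_nonzero _)⟩

/-- The continuous projection of `D` to its component `D_n`, with a constant value elsewhere. -/
def toComponent {n : ℕ} (y₀ : D 𝕜 n) : C(DTotal 𝕜, D 𝕜 n) :=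
  ⟨fun y => if h : y.1 = n then h ▸ y.2 else y₀, by
    refine continuous_sigma fun m => ?_
    by_cases h : m = n
    · subst h
      simp only [dite_true]
      exact continuous_id
    · simpa [h] using continuous_const⟩

lemma toComponent_mk {n : ℕ} (y₀ y : D 𝕜 n) : toComponent y₀ ⟨n, y⟩ = y :=
  dif_pos rfl

/-- The Atiyah action does not extend to one dimension more. -/
lemma no_action {τ : (ℕ → ℝ) → PInf 𝕜} {d : ℕ} (hd : 2 ≤ d)
    {hτ : Continuous fun p : USphere d => τ (pad p.1)}
    (hnull : ¬ (⟨_, hτ⟩ : C(USphere d, PInf 𝕜)).Nullhomotopic)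
    (B : Action (d + 1) (FlagTotal 𝕜)) (hB : IsAtiyahAction τ (B.restrict d.le_succ)) : False := by
  have hc : Continuous fun p : FM (d + 1) (Fin 2) => (B.act 2 p fun _ => baseFlag 𝕜).1 :=
    continuous_subtype_val.comp ((B.continuous_act 2).comp (continuous_id.prodMk continuous_const))
  obtain ⟨p₀⟩ : Nonempty (USphere d) := (connectedSpace_USphere hd).toNonempty
  -- Off the smaller operad the values of `B` are not known in advance to lie in the component of
  -- arity 2; the retraction forces this without changing them on `FM d (Fin 2)`. The constant used
  -- elsewhere is arbitrary.
  let r := toComponent (Quotient.mk (orbitSetoid 𝕜 2) (dirLabel τ (antipodal p₀)))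
  refine no_extension hd hnull (r.comp ⟨_, hc⟩) fun p => ?_
  have h := hB 2 p fun _ => baseFlag 𝕜
  change (B.act 2 (p.incl d.le_succ) fun _ => baseFlag 𝕜).1 = nu τ p fun _ => basePoint 𝕜 at h
  rw [nu_basePoint] at h ⊢
  exact congrArg (Sigma.mk 2) ((congrArg r h).trans (toComponent_mk _ _))

end FlagOperad

end

theorem mainTheorem3 :
    -- the Atiyah `E_3`-action on complex unordered flag manifolds has no extension
    (¬ ∃ B : FlagOperad.Action 4 (FlagOperad.FlagTotal ℂ),
      FlagOperad.IsAtiyahAction FlagOperad.stereoC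
        (B.restrict (show 3 ≤ 4 by norm_num))) ∧
    -- the Atiyah `E_2`-action on real unordered flag manifolds has no extension
    (¬ ∃ B : FlagOperad.Action 3 (FlagOperad.FlagTotal ℝ),
      FlagOperad.IsAtiyahAction FlagOperad.stereoR
        (B.restrict (show 2 ≤ 3 by norm_num))) ∧
    -- the map `p ↦ ν((p, -p), *, *)` is essential
    (∃ φ : C(Metric.sphere (0 : FlagOperad.E 3) 1, FlagOperad.D ℂ 2),
      (∀ p, (⟨2, φ p⟩ : FlagOperad.DTotal ℂ) =
        FlagOperad.nu FlagOperad.stereoC (FlagOperad.antipodal p)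
          fun _ => FlagOperad.basePoint ℂ) ∧
      ¬ φ.Nullhomotopic) ∧
    -- hence `ν(·, *, *)` does not extend to `FM_4(2)`
    (¬ ∃ g : C(FlagOperad.FM 4 (Fin 2), FlagOperad.D ℂ 2),
      ∀ p : FlagOperad.FM 3 (Fin 2),
        (⟨2, g (p.incl (show 3 ≤ 4 by norm_num))⟩ : FlagOperad.DTotal ℂ) =
          FlagOperad.nu FlagOperad.stereoC p fun _ => FlagOperad.basePoint ℂ) := by
  refine ⟨fun ⟨B, hB⟩ => FlagOperad.no_action (d := 3) (by norm_num)
      FlagOperad.stereoC_not_nullhomotopic B hB,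
    fun ⟨B, hB⟩ => FlagOperad.no_action (d := 2) le_rfl
      FlagOperad.stereoR_not_nullhomotopic B hB,
    ⟨(FlagOperad.orbitMap ℂ 2).comp
      (FlagOperad.antipodalClass _ FlagOperad.continuous_stereoC),
      fun p => (FlagOperad.nu_basePoint _ _).symm,
      FlagOperad.antipodalClass_not_nullhomotopic (by norm_num)
        FlagOperad.stereoC_not_nullhomotopic⟩,
    fun ⟨g, hg⟩ => FlagOperad.no_extension (d := 3) (by norm_num)
      FlagOperad.stereoC_not_nullhomotopic g hg⟩
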